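/- For an integer $n\ge 1$ let $V=\{u\in\mathbb{Z}^3:|u_1|+|u_2|+|u_3|=n\}$, and let the $n$-octahedral graph $G'_n$ be the undirected graph on $V$ in which distinct $v,w$ are adjacent if and only if $|v_i-w_i|\le 1$ for $i=1,2,3$. Let $d_{uv}$ be the graph distance in $G'_n$. The octahedral small-world model is the random directed graph $G_n$ on $V$ that contains both orientations of every edge of $G'_n$ and, in addition, for every $u\in V$ one long-range edge $(u,v)$, whose end $v\in V\setminus\{u\}$ is chosen, independently for different $u$, with probability $Z_u\,d_{uv}^{-2}$, where $Z_u=\big(\sum_{w\in V\setminus\{u\}}d_{uw}^{-2}\big)^{-1}$. The greedy routing algorithm sends a message from a source $s\in V$ to a target $t\in V$: as long as the current vertex $u$ is not $t$, it forwards the message to an out-neighbour $v$ of $u$ in $G_n$ with the smallest angle between $v$ and $t$ (seen from the origin), i.e. one that maximizes $\frac{v\cdot t}{|v||t|}$; ties are broken by any fixed rule that depends only on $u$, $t$ and the set of out-neighbours of $u$. Theorem. There is an absolute constant $C>0$ such that for every $n\ge 2$, every such tie-breaking rule and all $s,t\in V$, the expected number of forwards that the greedy routing algorithm performs in $G_n$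 until the message sent from $s$ reaches $t$ is at most $C\log^2 n$ (in particular, the message reaches $t$ almost surely). -/

import Mathlib

open scoped ENNReal

namespace OctahedralSmallWorld

/-- The vertex set `V` of the `n`-octahedral graph: integer points `u` with
`|u₁| + |u₂| + |u₃| = n`. -/
abbrev Vertex (n : ℕ) : Type := {u : Fin 3 → ℤ // ∑ i, |u i| = (n : ℤ)}

noncomputable instance instFintypeVertex (n : ℕ) : Fintype (Vertex n) :=
  Fintype.subtype
    ((Fintype.piFinset fun _ : Fin 3 => Finset.Icc (-(n : ℤ)) n).filter
      fun u => ∑ i, |u i| = (n : ℤ))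
    (by
      intro u
      simp only [Finset.mem_filter, Fintype.mem_piFinset, Finset.mem_Icc, and_iff_right_iff_imp]
      intro h i
      have h1 : |u i| ≤ ∑ j, |u j| :=
        Finset.single_le_sum (f := fun j => |u j|) (fun j _ => abs_nonneg _) (Finset.mem_univ i)
      exact abs_le.mp (h1.trans h.le))

/-- The `n`-octahedral graph: two distinct vertices are adjacent when they differ by at most `1`
in every coordinate. -/
def baseGraph (n : ℕ) : SimpleGraph (Vertex n) where
  Adj u v := u ≠ v ∧ ∀ i, |u.1 i - v.1 i| ≤ 1
  symm := ⟨fun u v h => ⟨h.1.symm, fun i => by rw [abs_sub_comm]; exact h.2 i⟩⟩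
  loopless := ⟨fun _ h => h.1 rfl⟩

/-- The normalizing factor `Z_u`, the inverse of the sum of `d(u, w)⁻²` over all `w ≠ u`, where
`d` is the graph distance of the `n`-octahedral graph. -/
noncomputable def normFactor (n : ℕ) (u : Vertex n) : ℝ :=
  (∑ w ∈ Finset.univ.erase u, (((baseGraph n).dist u w : ℝ) ^ 2)⁻¹)⁻¹

/-- The probability `Z_u * d(u, v)⁻²` that `u` chooses `v ≠ u` as the end of its long-range
edge. -/
noncomputable def linkProb (n : ℕ) (u v : Vertex n) : ℝ :=
  if v = u then 0 else normFactor n u * (((baseGraph n).dist u v : ℝ) ^ 2)⁻¹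

theorem exists_adj (n : ℕ) [NeZero n] (u : Vertex n) : ∃ v, (baseGraph n).Adj u v := by
  obtain ⟨u, hu⟩ := u
  have hn : (n : ℤ) ≠ 0 := by exact_mod_cast NeZero.ne n
  obtain ⟨i, -, hi⟩ : ∃ i ∈ Finset.univ, |u i| ≠ 0 := by
    apply Finset.exists_ne_zero_of_sum_ne_zero
    rw [hu]; exact hn
  have hi' : u i ≠ 0 := by simpa using hi
  obtain ⟨j, hji⟩ : ∃ j : Fin 3, j ≠ i := exists_ne i
  let a : ℤ := if 0 < u i then u i - 1 else u i + 1
  let b : ℤ := if 0 ≤ u j then u j + 1 else u j - 1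
  let v : Fin 3 → ℤ := Function.update (Function.update u i a) j b
  have ha : |a| = |u i| - 1 ∧ |u i - a| ≤ 1 ∧ a ≠ u i := by grind
  have hb : |b| = |u j| + 1 ∧ |u j - b| ≤ 1 := by grind
  have hvi : v i = a := by simp [v, hji.symm]
  have hvj : v j = b := by simp [v]
  have hvk : ∀ k, k ≠ i → k ≠ j → v k = u k := by
    intro k h1 h2; simp [v, h1, h2]
  have hv : ∑ k, |v k| = (n : ℤ) := by
    rw [← hu, ← sub_eq_zero, ← Finset.sum_sub_distrib,
      Finset.sum_eq_add_of_mem i j (Finset.mem_univ _) (Finset.mem_univ _) hji.symm]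
    · rw [hvi, hvj, ha.1, hb.1]; ring
    · intro k _ hk
      rw [hvk k hk.1 hk.2, sub_self]
  refine ⟨⟨v, hv⟩, ?_, fun k => ?_⟩
  · intro h
    have : u i = v i := congrFun (congrArg Subtype.val h) i
    exact ha.2.2 (hvi ▸ this.symm)
  · show |u k - v k| ≤ 1
    by_cases h1 : k = i
    · subst h1; rw [hvi]; exact ha.2.1
    · by_cases h2 : k = j
      · subst h2; rw [hvj]; exact hb.2
      · rw [hvk k h1 h2]; simp

theorem linkProb_nonneg (n : ℕ) (u v : Vertex n) : 0 ≤ linkProb n u v := by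
  unfold linkProb normFactor
  split_ifs
  · exact le_rfl
  · exact mul_nonneg (inv_nonneg.mpr (Finset.sum_nonneg fun _ _ => by positivity)) (by positivity)

theorem sum_linkProb (n : ℕ) [NeZero n] (u : Vertex n) : ∑ v, linkProb n u v = 1 := by
  have hpos : 0 < ∑ w ∈ Finset.univ.erase u, (((baseGraph n).dist u w : ℝ) ^ 2)⁻¹ := by
    obtain ⟨v, hv⟩ := exists_adj n u
    refine Finset.sum_pos' (fun _ _ => by positivity)
      ⟨v, Finset.mem_erase.mpr ⟨hv.ne', Finset.mem_univ _⟩, ?_⟩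
    rw [SimpleGraph.dist_eq_one_iff_adj.mpr hv]
    norm_num
  rw [← Finset.sum_erase (Finset.univ) (a := u) (by simp [linkProb])]
  have h : ∑ v ∈ Finset.univ.erase u, linkProb n u v =
      ∑ v ∈ Finset.univ.erase u, normFactor n u * (((baseGraph n).dist u v : ℝ) ^ 2)⁻¹ :=
    Finset.sum_congr rfl fun v hv => if_neg (Finset.ne_of_mem_erase hv)
  rw [h, ← Finset.mul_sum, normFactor]
  exact inv_mul_cancel₀ hpos.ne'

/-- The law of the end of the long-range edge of `u`. -/
noncomputable def linkPMF (n : ℕ) [NeZero n] (u : Vertex n) : PMF (Vertex n) :=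
  PMF.ofFintype (fun v => ENNReal.ofReal (linkProb n u v)) (by
    rw [← ENNReal.ofReal_sum_of_nonneg fun v _ => linkProb_nonneg n u v, sum_linkProb,
      ENNReal.ofReal_one])

/-- The law of the random choices of the model: every vertex `u` chooses, independently of the
others, the end `ω u` of its one long-range edge. -/
noncomputable def modelMeasure (n : ℕ) [NeZero n] :
    MeasureTheory.Measure (Vertex n → Vertex n) :=
  MeasureTheory.Measure.pi fun u => (linkPMF n u).toMeasure

/-- The octahedral small world digraph `G_n` produced by the choices `ω`: both orientations of
every edge of the `n`-octahedral graph, and the long-range edges `(u, ω u)`. -/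
def smallWorld (n : ℕ) (ω : Vertex n → Vertex n) : Digraph (Vertex n) where
  Adj u v := (baseGraph n).Adj u v ∨ v = ω u

/-- The set of out-neighbours of a vertex of a digraph. -/
def outNeighbors {V : Type*} (G : Digraph V) (u : V) : Set V := {v | G.Adj u v}

/-- The angle, seen from the origin, between two vertices of the octahedron. -/
noncomputable def vertexAngle {n : ℕ} (v t : Vertex n) : ℝ :=
  InnerProductGeometry.angle
    (WithLp.toLp 2 fun i => (v.1 i : ℝ) : EuclideanSpace ℝ (Fin 3))
    (WithLp.toLp 2 fun i => (t.1 i : ℝ) : EuclideanSpace ℝ (Fin 3))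

/-- A greedy forwarding rule: `r t u N` is the vertex to which `u`, whose set of out-neighbours is
`N`, forwards a message with target `t`. It is an element of `N` with the smallest angle to `t`;
ties are broken in an arbitrary way that depends on this local information only. -/
def IsGreedyRule {n : ℕ} (r : Vertex n → Vertex n → Set (Vertex n) → Vertex n) : Prop :=
  ∀ (t u : Vertex n) (N : Set (Vertex n)), N.Nonempty →
    r t u N ∈ N ∧ ∀ w ∈ N, vertexAngle (r t u N) t ≤ vertexAngle w t

/-- The vertex that holds the message after `k` forwards in the digraph `G`, from the source `s`
and with target `t`. -/
def route {n : ℕ} (r : Vertex n → Vertex n → Set (Vertex n) → Vertex n)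
    (G : Digraph (Vertex n)) (s t : Vertex n) (k : ℕ) : Vertex n :=
  (fun u => r t u (outNeighbors G u))^[k] s

/-- The number of forwards until the message first reaches the target; it is `⊤` when the message
never does. -/
noncomputable def forwards {n : ℕ} (r : Vertex n → Vertex n → Set (Vertex n) → Vertex n)
    (G : Digraph (Vertex n)) (s t : Vertex n) : ℕ∞ :=
  ⨅ (k : ℕ) (_ : route r G s t k = t), (k : ℕ∞)

end OctahedralSmallWorld

namespace OctahedralSmallWorld

open MeasureTheory

/-! This is Kleinberg's argument on a triangulated sphere. On the octahedron, graph distance, ℓ¹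
distance and `n` times the chord between directions agree up to constant factors. Hence the
inverse-square weights sum to `O(log n)` (`sum_dist_sq_inv_le_log`). About `D²` vertices lie so near
a target at distance `D` that hitting one halves the chord, so a long-range edge halves it with
probability at least a constant over `log n` (`le_sum_linkProb_halving`).

Greedy forwarding always makes strict progress (`exists_adj_closer`). The directions of the
triangles around `u` have no obtuse angle at `u`. If no neighbour improved on `u`, the target would
therefore lie in one of these triangles and be a neighbour itself.

Strict progress means that no vertex is revisited, so the long-range edge of the current vertex is
independent of the route after the next hop. A multiple of order `log n` of the logarithm of the
rescaled chord then drops by at least one in expectation per forward, and it starts at `O(log² n)`.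
-/

theorem exists_third {i j : Fin 3} (hij : i ≠ j) :
    ∃ k, k ≠ i ∧ k ≠ j ∧ (∀ l, l = i ∨ l = j ∨ l = k) := by
  revert i j; decide

theorem sum_fin_three_eq {M : Type*} [AddCommMonoid M] (f : Fin 3 → M) {i j k : Fin 3}
    (hij : i ≠ j) (hki : k ≠ i) (hkj : k ≠ j) : ∑ l, f l = f i + f j + f k := by
  have h : (Finset.univ : Finset (Fin 3)) = {i, j, k} := by
    revert i j k; decide
  rw [h, Finset.sum_insert (by simp [hij, hki.symm]), Finset.sum_insert (by simp [hkj.symm]),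
    Finset.sum_singleton, add_assoc]

/-- Two coordinates of a vertex may be replaced by values with the same sum of absolute values. -/
theorem exists_vertex_of_abs_add_abs {n : ℕ} (u : Vertex n) {i j : Fin 3} (hij : i ≠ j) {a b : ℤ}
    (h : |a| + |b| = |u.1 i| + |u.1 j|) :
    ∃ v : Vertex n, v.1 i = a ∧ v.1 j = b ∧ ∀ k, k ≠ i → k ≠ j → v.1 k = u.1 k := by
  obtain ⟨k, hki, hkj, hk⟩ := exists_third hij
  let f : Fin 3 → ℤ := Function.update (Function.update u.1 i a) j b
  have hi : f i = a := by simp [f, hij]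
  have hj : f j = b := by simp [f]
  have hl : ∀ l, l ≠ i → l ≠ j → f l = u.1 l := fun l h1 h2 => by simp [f, h1, h2]
  refine ⟨⟨f, ?_⟩, hi, hj, hl⟩
  have hu := u.2
  rw [sum_fin_three_eq _ hij hki hkj] at hu ⊢
  rw [hi, hj, hl k hki hkj]
  omega

/-! ### Graph distance against ℓ¹ distance. -/

/-- The `ℓ¹` distance of two vertices. -/
def l1dist {n : ℕ} (u v : Vertex n) : ℤ := ∑ i, |u.1 i - v.1 i|

theorem l1dist_nonneg {n : ℕ} (u v : Vertex n) : 0 ≤ l1dist u v :=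
  Finset.sum_nonneg fun _ _ => abs_nonneg _

theorem abs_sub_le_l1dist {n : ℕ} (u v : Vertex n) (i : Fin 3) : |u.1 i - v.1 i| ≤ l1dist u v :=
  Finset.single_le_sum (f := fun i => |u.1 i - v.1 i|) (fun _ _ => abs_nonneg _)
    (Finset.mem_univ i)

theorem l1dist_comm {n : ℕ} (u v : Vertex n) : l1dist u v = l1dist v u :=
  Finset.sum_congr rfl fun _ _ => abs_sub_comm _ _

theorem l1dist_triangle {n : ℕ} (u v w : Vertex n) : l1dist u w ≤ l1dist u v + l1dist v w := by
  unfold l1dist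
  rw [← Finset.sum_add_distrib]
  exact Finset.sum_le_sum fun i _ => abs_sub_le _ _ _

theorem eq_of_l1dist_le_zero {n : ℕ} {u v : Vertex n} (h : l1dist u v ≤ 0) : u = v := by
  ext i
  have := abs_sub_le_l1dist u v i
  grind

theorem one_le_l1dist {n : ℕ} {u v : Vertex n} (h : u ≠ v) : 1 ≤ l1dist u v := by
  by_contra h'
  exact h (eq_of_l1dist_le_zero (by omega))

theorem l1dist_le {n : ℕ} (u v : Vertex n) : l1dist u v ≤ 2 * n := by
  calc l1dist u v ≤ ∑ i, (|u.1 i| + |v.1 i|) := Finset.sum_le_sum fun i _ => abs_sub _ _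
    _ = 2 * n := by rw [Finset.sum_add_distrib, u.2, v.2]; ring

/-- Since both vertices have ℓ¹ norm `n`, a unit of mass can be moved from a coordinate where `u`
has too much to one where it has too little. This is an edge, and it brings both coordinates nearer
to `v`. -/
theorem exists_walk_of_same_octant {n : ℕ} (m : ℕ) (u v : Vertex n)
    (ho : ∀ i, 0 ≤ u.1 i * v.1 i) (hd : l1dist u v ≤ m) :
    ∃ p : (baseGraph n).Walk u v, p.length ≤ m := by
  induction m generalizing u with
  | zero =>
    obtain rfl := eq_of_l1dist_le_zero (by simpa using hd)
    exact ⟨.nil, by simp⟩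
  | succ m ih =>
    by_cases huv : u = v
    · subst huv
      exact ⟨.nil, by simp⟩
    have hsum : ∑ i, |u.1 i| = ∑ i, |v.1 i| := by rw [u.2, v.2]
    obtain ⟨l, hl⟩ : ∃ l, |u.1 l| ≠ |v.1 l| := by
      by_contra! h
      apply huv
      ext i
      have h1 := h i
      have h2 := ho i
      rcases abs_eq_abs.mp h1 with h3 | h3
      · exact h3
      · rw [h3] at h2 ⊢
        have : v.1 i = 0 := by nlinarith
        simp [this]
    obtain ⟨i, -, hi⟩ : ∃ i ∈ Finset.univ, |v.1 i| < |u.1 i| := by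
      by_contra! h
      exact hl (((Finset.sum_eq_sum_iff_of_le h).mp hsum) l (Finset.mem_univ l))
    obtain ⟨j, -, hj⟩ : ∃ i ∈ Finset.univ, |u.1 i| < |v.1 i| := by
      by_contra! h
      exact hl (((Finset.sum_eq_sum_iff_of_le h).mp hsum.symm) l (Finset.mem_univ l)).symm
    have hij : i ≠ j := by rintro rfl; omega
    obtain ⟨k, hki, hkj, hk⟩ := exists_third hij
    let a : ℤ := if 0 < u.1 i then u.1 i - 1 else u.1 i + 1
    -- The sign is read off `v`, because `u.1 j` may vanish while `v.1 j` cannot.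
    let b : ℤ := if 0 < v.1 j then u.1 j + 1 else u.1 j - 1
    have hoi := ho i
    have hoj := ho j
    have ha : |a| = |u.1 i| - 1 ∧ |u.1 i - a| ≤ 1 ∧ |a - v.1 i| < |u.1 i - v.1 i| ∧
        0 ≤ a * v.1 i := by
      rcases lt_trichotomy (u.1 i) 0 with h | h | h
      · have : v.1 i ≤ 0 := by nlinarith
        have ha : a = u.1 i + 1 := by simp [a, h.le]
        refine ⟨by grind, by grind, by grind, ?_⟩
        exact mul_nonneg_of_nonpos_of_nonpos (by omega) this
      · grind
      · have : 0 ≤ v.1 i := by nlinarith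
        have ha : a = u.1 i - 1 := by simp [a, h]
        refine ⟨by grind, by grind, by grind, ?_⟩
        exact mul_nonneg (by omega) this
    have hb : |b| = |u.1 j| + 1 ∧ |u.1 j - b| ≤ 1 ∧ |b - v.1 j| < |u.1 j - v.1 j| ∧
        0 ≤ b * v.1 j ∧ b ≠ u.1 j := by
      rcases lt_trichotomy (v.1 j) 0 with h | h | h
      · have : u.1 j ≤ 0 := by nlinarith
        have hb : b = u.1 j - 1 := by simp [b, h.le]
        refine ⟨by grind, by grind, by grind, ?_, by grind⟩
        exact mul_nonneg_of_nonpos_of_nonpos (by omega) h.le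
      · grind
      · have : 0 ≤ u.1 j := by nlinarith
        have hb : b = u.1 j + 1 := by simp [b, h]
        refine ⟨by grind, by grind, by grind, ?_, by grind⟩
        exact mul_nonneg (by omega) h.le
    obtain ⟨w, hwi, hwj, hwk⟩ :=
      exists_vertex_of_abs_add_abs u hij (a := a) (b := b) (by omega)
    have hwk' := hwk k hki hkj
    have hadj : (baseGraph n).Adj u w := by
      refine ⟨fun h => hb.2.2.2.2 (by rw [← hwj, h]), fun l => ?_⟩
      rcases hk l with rfl | rfl | rfl
      · rw [hwi]; exact ha.2.1
      · rw [hwj]; exact hb.2.1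
      · rw [hwk']; simp
    obtain ⟨p, hp⟩ := ih w (fun l => by
      rcases hk l with rfl | rfl | rfl
      · rw [hwi]; exact ha.2.2.2
      · rw [hwj]; exact hb.2.2.2.1
      · rw [hwk']; exact ho _) (by
      unfold l1dist at hd ⊢
      rw [sum_fin_three_eq _ hij hki hkj] at hd ⊢
      rw [hwi, hwj, hwk']
      push_cast at hd
      omega)
    exact ⟨.cons hadj p, by simpa using hp⟩

/-- `S` contains the coordinates where signs may clash. A clash at `i` is removed by pushing all
mass of `i` onto another coordinate. Opposite signs give `|u.1 i| ≤ D`, with `D` the ℓ¹ distance, so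
this costs at most `2 * D` steps and leaves distance at most `3 * D`: a factor `5` per coordinate.
-/
theorem exists_walk_length_le_of_finset {n : ℕ} (S : Finset (Fin 3)) (u v : Vertex n)
    (ho : ∀ i ∉ S, 0 ≤ u.1 i * v.1 i) :
    ∃ p : (baseGraph n).Walk u v, (p.length : ℤ) ≤ 5 ^ S.card * l1dist u v := by
  induction S using Finset.induction_on generalizing u with
  | empty =>
    obtain ⟨p, hp⟩ := exists_walk_of_same_octant (l1dist u v).toNat u v (fun i => ho i (by simp))
      (Int.self_le_toNat _)
    refine ⟨p, ?_⟩
    have := l1dist_nonneg u v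
    simp only [Finset.card_empty, pow_zero, one_mul]
    omega
  | insert i S hiS ih =>
    rw [Finset.card_insert_of_notMem hiS]
    have h5 : (1 : ℤ) ≤ 5 ^ S.card := one_le_pow₀ (by norm_num)
    have hD := l1dist_nonneg u v
    by_cases hi : 0 ≤ u.1 i * v.1 i
    · obtain ⟨p, hp⟩ := ih u (fun l hl => by
        by_cases h : l = i
        · rwa [h]
        · exact ho l (by simp [h, hl]))
      refine ⟨p, hp.trans ?_⟩
      rw [pow_succ]
      nlinarith [mul_nonneg (zero_le_one.trans h5) hD]
    · obtain ⟨j, hji⟩ : ∃ j : Fin 3, j ≠ i := exists_ne i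
      obtain ⟨k, hki, hkj, hk⟩ := exists_third hji.symm
      obtain ⟨b, hb1, hb2, hb3, hb4⟩ : ∃ b : ℤ, |b| = |u.1 i| + |u.1 j| ∧ 0 ≤ u.1 j * b ∧
          |u.1 j - b| = |u.1 i| ∧ (0 ≤ u.1 j * v.1 j → 0 ≤ b * v.1 j) := by
        have h0 := abs_nonneg (u.1 i)
        rcases lt_trichotomy (u.1 j) 0 with h | h | h
        · refine ⟨u.1 j - |u.1 i|, by grind, ?_, by grind, fun h1 => ?_⟩
          · exact mul_nonneg_of_nonpos_of_nonpos h.le (by omega)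
          · have : v.1 j ≤ 0 := by nlinarith
            exact mul_nonneg_of_nonpos_of_nonpos (by omega) this
        · by_cases h1 : 0 ≤ v.1 j
          · exact ⟨|u.1 i|, by simp [h], by simp [h], by simp [h], fun _ => mul_nonneg h0 h1⟩
          · refine ⟨-|u.1 i|, by simp [h], by simp [h], by simp [h], fun _ => ?_⟩
            exact mul_nonneg_of_nonpos_of_nonpos (by omega) (by omega)
        · refine ⟨u.1 j + |u.1 i|, by grind, ?_, by grind, fun h1 => ?_⟩
          · exact mul_nonneg h.le (by omega)
          · have : 0 ≤ v.1 j := by nlinarith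
            exact mul_nonneg (by omega) this
      obtain ⟨w, hwi, hwj, hwk⟩ :=
        exists_vertex_of_abs_add_abs u hji.symm (a := 0) (b := b) (by simpa using hb1)
      have hwk' := hwk k hki hkj
      have huw : l1dist u w = 2 * |u.1 i| := by
        unfold l1dist
        rw [sum_fin_three_eq _ hji.symm hki hkj, hwi, hwj, hwk', hb3]
        simp only [sub_zero, sub_self, abs_zero]
        ring
      have hui : |u.1 i| ≤ l1dist u v := by
        refine le_trans ?_ (abs_sub_le_l1dist u v i)
        have : u.1 i * v.1 i < 0 := by omega
        rcases mul_neg_iff.mp this with h | h <;> grind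
      obtain ⟨p, hp⟩ := exists_walk_of_same_octant (l1dist u w).toNat u w (fun l => by
        rcases hk l with rfl | rfl | rfl
        · simp [hwi]
        · rw [hwj]; exact hb2
        · rw [hwk']; exact mul_self_nonneg _) (Int.self_le_toNat _)
      obtain ⟨q, hq⟩ := ih w (fun l hl => by
        rcases hk l with rfl | rfl | rfl
        · simp [hwi]
        · rw [hwj]; exact hb4 (ho _ (by simp [hji, hl]))
        · rw [hwk']; exact ho _ (by simp [hki, hl]))
      refine ⟨p.append q, ?_⟩
      rw [SimpleGraph.Walk.length_append, pow_succ]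
      push_cast
      have h1 := l1dist_triangle w u v
      rw [l1dist_comm w u] at h1
      have h2 : (5 : ℤ) ^ S.card * l1dist w v ≤ 5 ^ S.card * (3 * l1dist u v) :=
        mul_le_mul_of_nonneg_left (by omega) (by omega)
      have h3 : l1dist u v ≤ 5 ^ S.card * l1dist u v := le_mul_of_one_le_left hD h5
      have := l1dist_nonneg u w
      have h4 : (p.length : ℤ) ≤ l1dist u w := by omega
      linarith

theorem exists_walk_length_le {n : ℕ} (u v : Vertex n) :
    ∃ p : (baseGraph n).Walk u v, (p.length : ℤ) ≤ 125 * l1dist u v := by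
  simpa using exists_walk_length_le_of_finset Finset.univ u v (by simp)

theorem baseGraph_reachable {n : ℕ} (u v : Vertex n) : (baseGraph n).Reachable u v :=
  let ⟨p, _⟩ := exists_walk_length_le u v
  ⟨p⟩

theorem dist_le_l1dist {n : ℕ} (u v : Vertex n) :
    ((baseGraph n).dist u v : ℤ) ≤ 125 * l1dist u v := by
  obtain ⟨p, hp⟩ := exists_walk_length_le u v
  exact le_trans (by exact_mod_cast SimpleGraph.dist_le p) hp

theorem abs_sub_le_length {n : ℕ} {u v : Vertex n} (p : (baseGraph n).Walk u v) (i : Fin 3) :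
    |u.1 i - v.1 i| ≤ p.length := by
  induction p with
  | nil => simp
  | @cons u w v h p ih =>
    have := h.2 i
    rw [SimpleGraph.Walk.length_cons]
    push_cast
    linarith [abs_sub_le (u.1 i) (w.1 i) (v.1 i)]

theorem abs_sub_le_dist {n : ℕ} (u v : Vertex n) (i : Fin 3) :
    |u.1 i - v.1 i| ≤ (baseGraph n).dist u v := by
  obtain ⟨p, hp⟩ := (baseGraph_reachable u v).exists_walk_length_eq_dist
  rw [← hp]
  exact abs_sub_le_length p i

/-! ### The normalizing sum is `O(log n)`. -/

/-- The sup-distance of two vertices in the first two coordinates. -/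
def planarDist {n : ℕ} (u w : Vertex n) : ℕ :=
  max (w.1 0 - u.1 0).natAbs (w.1 1 - u.1 1).natAbs

theorem planarDist_le_dist {n : ℕ} (u w : Vertex n) :
    planarDist u w ≤ (baseGraph n).dist u w := by
  have h0 := abs_sub_le_dist u w 0
  have h1 := abs_sub_le_dist u w 1
  rw [abs_le] at h0 h1
  unfold planarDist
  omega

theorem planarDist_le {n : ℕ} (u w : Vertex n) : planarDist u w ≤ 2 * n := by
  have h0 := (abs_sub_le_l1dist u w 0).trans (l1dist_le u w)
  have h1 := (abs_sub_le_l1dist u w 1).trans (l1dist_le u w)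
  rw [abs_le] at h0 h1
  unfold planarDist
  omega

/-- Forgetting the third coordinate is at most two-to-one, since the other two determine its
absolute value. -/
theorem card_planarDist_eq_le {n : ℕ} (u : Vertex n) (k : ℕ) :
    (Finset.univ.filter fun w => planarDist u w = k).card ≤
      2 * (Finset.box k : Finset (ℤ × ℤ)).card := by
  classical
  set s := Finset.univ.filter fun w => planarDist u w = k
  let φ : Vertex n → ℤ × ℤ := fun w => (w.1 0 - u.1 0, w.1 1 - u.1 1)
  have him : s.image φ ⊆ Finset.box k := by
    intro z hz
    obtain ⟨w, hw, rfl⟩ := Finset.mem_image.mp hz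
    exact Int.mem_box.mpr (Finset.mem_filter.mp hw).2
  refine (Finset.card_le_mul_card_image (f := φ) s 2 fun z _ => ?_).trans
    (Nat.mul_le_mul_left 2 (Finset.card_le_card him))
  set c : ℤ := n - |z.1 + u.1 0| - |z.2 + u.1 1|
  have hmaps : ∀ w ∈ s.filter fun x => φ x = z, w.1 2 ∈ ({c, -c} : Finset ℤ) := by
    intro w hw
    have hz : φ w = z := (Finset.mem_filter.mp hw).2
    have hw2 := w.2
    rw [Fin.sum_univ_three] at hw2
    have h1 : z.1 + u.1 0 = w.1 0 := by rw [← hz]; simp [φ]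
    have h2 : z.2 + u.1 1 = w.1 1 := by rw [← hz]; simp [φ]
    simp only [Finset.mem_insert, Finset.mem_singleton, c, h1, h2]
    rcases abs_choice (w.1 2) with h | h <;> omega
  refine (Finset.card_le_card_of_injOn (fun w : Vertex n => w.1 2) hmaps ?_).trans
    Finset.card_le_two
  intro v hv w hw hvw
  have hv' : φ v = z := (Finset.mem_filter.mp hv).2
  have hw' : φ w = z := (Finset.mem_filter.mp hw).2
  have h := hv'.trans hw'.symm
  simp only [φ, Prod.mk.injEq, sub_left_inj] at h
  ext i
  fin_cases i
  · exact h.1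
  · exact h.2
  · exact hvw

theorem sum_dist_sq_inv_le_harmonic {n : ℕ} (u : Vertex n) :
    ∑ w ∈ Finset.univ.erase u, (((baseGraph n).dist u w : ℝ) ^ 2)⁻¹ ≤
      2 + 16 * (harmonic (2 * n) : ℝ) := by
  -- The maximum with `1` covers the mirror image of `u` in the third coordinate, which has planar
  -- distance `0`.
  have h1 : ∀ w ∈ Finset.univ.erase u, (((baseGraph n).dist u w : ℝ) ^ 2)⁻¹ ≤
      ((max 1 (planarDist u w : ℝ)) ^ 2)⁻¹ := by
    intro w hw
    have hpos : 0 < (baseGraph n).dist u w :=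
      (baseGraph_reachable u w).pos_dist_of_ne (Finset.ne_of_mem_erase hw).symm
    have h : max 1 (planarDist u w : ℝ) ≤ (baseGraph n).dist u w :=
      max_le (by exact_mod_cast hpos) (by exact_mod_cast planarDist_le_dist u w)
    gcongr
  calc _ ≤ ∑ w ∈ Finset.univ.erase u, ((max 1 (planarDist u w : ℝ)) ^ 2)⁻¹ :=
        Finset.sum_le_sum h1
    _ ≤ ∑ w, ((max 1 (planarDist u w : ℝ)) ^ 2)⁻¹ :=
        Finset.sum_le_sum_of_subset_of_nonneg (Finset.erase_subset _ _)
          fun _ _ _ => by positivity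
    _ = ∑ k ∈ Finset.range (2 * n + 1), ∑ w ∈ Finset.univ.filter fun w => planarDist u w = k,
          ((max 1 (planarDist u w : ℝ)) ^ 2)⁻¹ :=
        (Finset.sum_fiberwise_of_maps_to
          (fun w _ => Finset.mem_range.mpr (Nat.lt_succ_of_le (planarDist_le u w))) _).symm
    _ = ∑ k ∈ Finset.range (2 * n + 1), ((Finset.univ.filter fun w => planarDist u w = k).card : ℝ)
          * ((max 1 (k : ℝ)) ^ 2)⁻¹ := by
        refine Finset.sum_congr rfl fun k _ => ?_
        rw [← nsmul_eq_mul]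
        refine Finset.sum_eq_card_nsmul fun w hw => ?_
        rw [(Finset.mem_filter.mp hw).2]
    _ ≤ ∑ k ∈ Finset.range (2 * n + 1), ((2 * (Finset.box k : Finset (ℤ × ℤ)).card : ℕ) : ℝ)
          * ((max 1 (k : ℝ)) ^ 2)⁻¹ := by
        gcongr with k
        exact card_planarDist_eq_le u k
    -- Shell `0` contributes `2`; shell `k ≥ 1` is counted by `2 * 8 * k` and contributes `16 / k`.
    _ = 2 + 16 * (harmonic (2 * n) : ℝ) := by
        rw [Finset.sum_range_succ', add_comm]
        congr 1
        · simp
        · rw [harmonic]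
          push_cast
          rw [Finset.mul_sum]
          refine Finset.sum_congr rfl fun k _ => ?_
          rw [Int.card_box (Nat.succ_ne_zero k), max_eq_right (by norm_cast; omega)]
          push_cast
          field_simp
          norm_num

theorem sum_dist_sq_inv_le_log {n : ℕ} (hn : 2 ≤ n) (u : Vertex n) :
    ∑ w ∈ Finset.univ.erase u, (((baseGraph n).dist u w : ℝ) ^ 2)⁻¹ ≤ 80 * Real.log n := by
  have h1 := sum_dist_sq_inv_le_harmonic u
  have h2 := harmonic_le_one_add_log (2 * n)
  have hn0 : (n : ℝ) ≠ 0 := by positivity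
  push_cast at h2
  rw [Real.log_mul (by norm_num) hn0] at h2
  have h3 : Real.log 2 ≤ Real.log n := Real.log_le_log (by norm_num) (by exact_mod_cast hn)
  have := Real.log_two_gt_d9
  linarith

/-! ### Quadratic growth of balls. -/

theorem exists_third_le_abs {n : ℕ} (t : Vertex n) : ∃ i, (n : ℤ) ≤ 3 * |t.1 i| := by
  by_contra! h
  have h2 := t.2
  rw [Fin.sum_univ_three] at h2
  have := h 0
  have := h 1
  have := h 2
  omega

/-- A vertex is surrounded by quadratically many vertices at small `ℓ¹` distance. -/
theorem sq_le_card_l1dist_le {n : ℕ} (t : Vertex n) (m : ℕ) (hm : 6 * m ≤ n) :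
    (m + 1) ^ 2 ≤ (Finset.univ.filter fun v => l1dist v t ≤ 4 * m).card := by
  obtain ⟨i, hi⟩ := exists_third_le_abs t
  obtain ⟨j, hji⟩ : ∃ j : Fin 3, j ≠ i := exists_ne i
  obtain ⟨k, hki, hkj, hk⟩ := exists_third hji.symm
  -- Coordinates `j` and `k` grow outward by `a, b ≤ m`, paid for by coordinate `i`, whose absolute
  -- value is at least `n / 3 ≥ 2 * m`. The ℓ¹ displacement is `2 * (a + b)`.
  have key : ∀ x : ℕ × ℕ, x ∈ Finset.range (m + 1) ×ˢ Finset.range (m + 1) → ∃ v : Vertex n,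
      |v.1 j| = |t.1 j| + x.1 ∧ |v.1 k| = |t.1 k| + x.2 ∧ l1dist v t ≤ 4 * m := by
    rintro ⟨a, b⟩ hx
    simp only [Finset.mem_product, Finset.mem_range] at hx
    have hex : ∀ (z : ℤ) (c : ℕ), ∃ y : ℤ, |y| = |z| + c ∧ |y - z| = c := by
      intro z c
      by_cases h : 0 ≤ z
      · exact ⟨z + c, by grind, by grind⟩
      · exact ⟨z - c, by grind, by grind⟩
    obtain ⟨y, hy, hy'⟩ := hex (t.1 j) a
    obtain ⟨z, hz, hz'⟩ := hex (t.1 k) b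
    obtain ⟨x, hx1, hx2⟩ : ∃ x : ℤ, |x| = |t.1 i| - (a + b) ∧ |x - t.1 i| = a + b := by
      by_cases h : 0 ≤ t.1 i
      · exact ⟨t.1 i - (a + b), by grind, by grind⟩
      · exact ⟨t.1 i + (a + b), by grind, by grind⟩
    have ht := t.2
    rw [sum_fin_three_eq _ hji.symm hki hkj] at ht
    obtain ⟨v, hvi, hvj, hvk⟩ : ∃ v : Vertex n, v.1 i = x ∧ v.1 j = y ∧ v.1 k = z := by
      let f : Fin 3 → ℤ := fun l => if l = i then x else if l = j then y else z
      have h1 : f i = x := by simp [f]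
      have h2 : f j = y := by simp [f, hji]
      have h3 : f k = z := by simp [f, hki, hkj]
      exact ⟨⟨f, by rw [sum_fin_three_eq _ hji.symm hki hkj, h1, h2, h3]; omega⟩, h1, h2, h3⟩
    refine ⟨v, by rw [hvj, hy], by rw [hvk, hz], ?_⟩
    unfold l1dist
    rw [sum_fin_three_eq _ hji.symm hki hkj, hvi, hvj, hvk]
    omega
  have : Nonempty (Vertex n) := ⟨t⟩
  choose! f hf using key
  calc (m + 1) ^ 2 = (Finset.range (m + 1) ×ˢ Finset.range (m + 1)).card := by
        simp [sq]
    _ ≤ _ := by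
        refine Finset.card_le_card_of_injOn f (fun x hx => ?_) ?_
        · simpa using (hf x hx).2.2
        · intro x hx y hy hxy
          have h1 := hf x hx
          have h2 := hf y hy
          rw [hxy] at h1
          ext <;> omega

/-! ### Some neighbour is always strictly closer in direction. -/

/-- The coefficient of `u` is nonnegative in any expansion of `t` along `u`, `v` and `w` in which
`v` and `w` have nonnegative coefficients, if `u` makes the smallest angle with `t` and the
directions of `u`, `v`, `w` form a triangle that is not obtuse at `u`. -/
theorem coeff_nonneg_of_nonobtuse {E : Type*} [NormedAddCommGroup E] [InnerProductSpace ℝ E]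
    {u v w t : E} {α β γ : ℝ} (huv : inner ℝ u v < ‖u‖ * ‖v‖) (huw : inner ℝ u w < ‖u‖ * ‖w‖)
    (hacute : 0 ≤ inner ℝ (‖v‖ • u - ‖u‖ • v) (‖w‖ • u - ‖u‖ • w))
    (ht : t = α • u + β • v + γ • w) (hβ : 0 ≤ β) (hγ : 0 ≤ γ)
    (htv : inner ℝ t v * ‖u‖ ≤ inner ℝ t u * ‖v‖)
    (htw : inner ℝ t w * ‖u‖ ≤ inner ℝ t u * ‖w‖) : 0 ≤ α := by
  have hu : 0 < ‖u‖ := by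
    rw [norm_pos_iff]
    rintro rfl
    simp at huv
  set A := ‖u‖
  set B := ‖v‖
  set C := ‖w‖
  have huu : inner ℝ u u = A ^ 2 := real_inner_self_eq_norm_sq u
  have hvv : inner ℝ v v = B ^ 2 := real_inner_self_eq_norm_sq v
  have hww : inner ℝ w w = C ^ 2 := real_inner_self_eq_norm_sq w
  have hvu : inner ℝ v u = inner ℝ u v := real_inner_comm _ _
  have hwu : inner ℝ w u = inner ℝ u w := real_inner_comm _ _
  have hwv : inner ℝ w v = inner ℝ v w := real_inner_comm _ _
  rw [ht] at htv htw
  simp only [inner_add_left, inner_smul_left, inner_sub_left, inner_sub_right,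
    inner_smul_right, RCLike.conj_to_real, huu, hvv, hww, hvu, hwu, hwv] at htv htw hacute
  generalize inner ℝ u v = p at *
  generalize inner ℝ u w = q at *
  generalize inner ℝ v w = s at *
  have h1 : 0 < A * B - p := by linarith
  have h2 : 0 < A * C - q := by linarith
  -- `K` is the inner product of `hacute` divided by `A`.
  set K := A * (B * C) - B * q - C * p + A * s with hK
  have hK0 : 0 ≤ K := by
    by_contra! h
    nlinarith
  -- This is `htv` with `γ * C * (A * B - p)` added to both sides; `e2` is its mirror image. The
  -- last factors of `e1` and `e2` add up to `2 * α * A`.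
  have e1 : γ * K ≤ (A * B - p) * (α * A - β * B + γ * C) := by
    rw [hK]; linarith
  have e2 : β * K ≤ (A * C - q) * (α * A + β * B - γ * C) := by
    rw [hK]; linarith
  have f1 : 0 ≤ α * A - β * B + γ * C :=
    nonneg_of_mul_nonneg_right ((mul_nonneg hγ hK0).trans e1) h1
  have f2 : 0 ≤ α * A + β * B - γ * C :=
    nonneg_of_mul_nonneg_right ((mul_nonneg hβ hK0).trans e2) h2
  exact nonneg_of_mul_nonneg_left (by linarith) hu

/-- Scalar form of the non-obtuseness below, with `x = ‖u‖ - ‖v‖` and `y = ‖u‖ - ‖w‖`: for sides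
`√2`, the inner product there equals `A / 2` times right side minus left side. -/
theorem two_mul_le_of_side_bounds {A x y : ℝ} (hA : 1 ≤ A) (hx : x ≤ 1) (hy : y ≤ 1)
    (hx' : -1 ≤ x) (hy' : -1 ≤ y)
    (hxA : 2 * A * x ≤ x ^ 2 + 2 * A - 2) (hyA : 2 * A * y ≤ y ^ 2 + 2 * A - 2) :
    2 * A ≤ (2 * A - x - y) * (2 - x * y) := by
  rcases le_total 0 x with h1 | h1 <;> rcases le_total 0 y with h2 | h2
  · have h3 : x * (2 * A * y) ≤ x * (y ^ 2 + 2 * A - 2) := mul_le_mul_of_nonneg_left hyA h1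
    have h4 : 0 ≤ (2 - x ^ 2) * (1 - y) := mul_nonneg (by nlinarith) (by linarith)
    nlinarith
  · nlinarith [mul_nonneg h1 (neg_nonneg.mpr h2), mul_nonneg (mul_nonneg h1 (neg_nonneg.mpr h2)) (by linarith : 0 ≤ 2 * A - x - y)]
  · nlinarith [mul_nonneg h2 (neg_nonneg.mpr h1), mul_nonneg (mul_nonneg h2 (neg_nonneg.mpr h1)) (by linarith : 0 ≤ 2 * A - x - y)]
  · have h3 : 0 ≤ x * y := mul_nonneg_of_nonpos_of_nonpos h1 h2
    have h4 : x * y ≤ 1 := by nlinarith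
    nlinarith [mul_nonneg (by linarith : 0 ≤ -x - y) (by linarith : 0 ≤ 1 - x * y)]

/-- The flat triangle is equilateral, but radial projection to the sphere distorts it. The norm
bounds, which hold for transfers within an octant, keep the distortion from making the angle at `u`
obtuse. -/
theorem nonobtuse_of_side_bounds {E : Type*} [NormedAddCommGroup E] [InnerProductSpace ℝ E]
    {u v w : E} (hu : 1 ≤ ‖u‖) (huv : ‖u - v‖ ^ 2 = 2) (huw : ‖u - w‖ ^ 2 = 2)
    (hvw : ‖v - w‖ ^ 2 = 2)
    (hv1 : ‖u‖ ^ 2 - ‖v‖ ^ 2 ≤ 2 * ‖u‖ - 2) (hv2 : ‖v‖ ≤ ‖u‖ + 1)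
    (hw1 : ‖u‖ ^ 2 - ‖w‖ ^ 2 ≤ 2 * ‖u‖ - 2) (hw2 : ‖w‖ ≤ ‖u‖ + 1) :
    0 ≤ inner ℝ (‖v‖ • u - ‖u‖ • v) (‖w‖ • u - ‖u‖ • w) := by
  have huu : inner ℝ u u = ‖u‖ ^ 2 := real_inner_self_eq_norm_sq u
  have hvu : inner ℝ v u = inner ℝ u v := real_inner_comm _ _
  rw [norm_sub_sq_real] at huv huw hvw
  simp only [inner_smul_left, inner_sub_left, inner_sub_right,
    inner_smul_right, RCLike.conj_to_real, huu, hvu]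
  have hB := norm_nonneg v
  have hC := norm_nonneg w
  set A := ‖u‖
  set B := ‖v‖
  set C := ‖w‖
  have key := two_mul_le_of_side_bounds (A := A) (x := A - B) (y := A - C) hu
    (by nlinarith) (by nlinarith) (by linarith) (by linarith) (by nlinarith) (by nlinarith)
  generalize inner ℝ u v = p at *
  generalize inner ℝ u w = q at *
  generalize inner ℝ v w = s at *
  have hp : p = (A ^ 2 + B ^ 2 - 2) / 2 := by linarith
  have hq : q = (A ^ 2 + C ^ 2 - 2) / 2 := by linarith
  have hs : s = (B ^ 2 + C ^ 2 - 2) / 2 := by linarith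
  subst hp hq hs
  have := mul_nonneg (by linarith : 0 ≤ A) (sub_nonneg.mpr key)
  linarith

/-- A vertex as a point of Euclidean space. -/
noncomputable def toEuclidean {n : ℕ} (v : Vertex n) : EuclideanSpace ℝ (Fin 3) :=
  WithLp.toLp 2 fun i => (v.1 i : ℝ)

@[simp] theorem toEuclidean_apply {n : ℕ} (v : Vertex n) (i : Fin 3) :
    toEuclidean v i = (v.1 i : ℝ) := rfl

theorem norm_sq_toEuclidean {n : ℕ} (v : Vertex n) :
    ‖toEuclidean v‖ ^ 2 = ((∑ i, v.1 i ^ 2 : ℤ) : ℝ) := by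
  rw [EuclideanSpace.norm_sq_eq]
  push_cast
  simp

theorem sum_abs_toEuclidean {n : ℕ} (v : Vertex n) : ∑ i, |(v.1 i : ℝ)| = n := by
  exact_mod_cast congrArg (Int.cast (R := ℝ)) v.2

theorem abs_le_norm_toEuclidean {n : ℕ} (v : Vertex n) (i : Fin 3) :
    |(v.1 i : ℝ)| ≤ ‖toEuclidean v‖ := by
  simpa using PiLp.norm_apply_le (toEuclidean v) i

theorem norm_toEuclidean_le {n : ℕ} (v : Vertex n) : ‖toEuclidean v‖ ≤ n := by
  rw [← pow_le_pow_iff_left₀ (norm_nonneg _) (Nat.cast_nonneg' n) two_ne_zero,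
    norm_sq_toEuclidean]
  have h := v.2
  rw [Fin.sum_univ_three] at h
  have : ∑ i, v.1 i ^ 2 ≤ (n : ℤ) ^ 2 := by
    rw [Fin.sum_univ_three, ← sq_abs (v.1 0), ← sq_abs (v.1 1), ← sq_abs (v.1 2)]
    have h0 := abs_nonneg (v.1 0)
    have h1 := abs_nonneg (v.1 1)
    have h2 := abs_nonneg (v.1 2)
    calc _ ≤ (|v.1 0| + |v.1 1| + |v.1 2|) ^ 2 := by
          nlinarith [mul_nonneg h0 h1, mul_nonneg h0 h2, mul_nonneg h1 h2]
      _ = _ := congrArg (· ^ 2) h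
  exact_mod_cast this

theorem le_three_mul_norm_toEuclidean {n : ℕ} (v : Vertex n) : (n : ℝ) ≤ 3 * ‖toEuclidean v‖ := by
  rw [← sum_abs_toEuclidean v, Fin.sum_univ_three]
  linarith [abs_le_norm_toEuclidean v 0, abs_le_norm_toEuclidean v 1,
    abs_le_norm_toEuclidean v 2]

theorem one_le_norm_toEuclidean {n : ℕ} [NeZero n] (v : Vertex n) : 1 ≤ ‖toEuclidean v‖ := by
  obtain ⟨i, hi⟩ := exists_third_le_abs v
  have hn : 0 < n := NeZero.pos n
  refine le_trans ?_ (abs_le_norm_toEuclidean v i)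
  exact_mod_cast (show 1 ≤ |v.1 i| by omega)

/-- Equality in Cauchy–Schwarz makes the vertices positive multiples of each other, and both have ℓ¹
norm `n`. -/
theorem inner_lt_norm_mul_norm {n : ℕ} [NeZero n] {u v : Vertex n} (h : u ≠ v) :
    inner ℝ (toEuclidean u) (toEuclidean v) < ‖toEuclidean u‖ * ‖toEuclidean v‖ := by
  refine lt_of_le_of_ne (real_inner_le_norm _ _) fun he => h ?_
  rw [inner_eq_norm_mul_iff_real] at he
  have hu := one_le_norm_toEuclidean u
  have hv := one_le_norm_toEuclidean v
  have hcoord : ∀ i, ‖toEuclidean v‖ * (u.1 i : ℝ) = ‖toEuclidean u‖ * (v.1 i : ℝ) := fun i => by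
    simpa using congrArg (fun x : EuclideanSpace ℝ (Fin 3) => x i) he
  have hsum : ‖toEuclidean v‖ * n = ‖toEuclidean u‖ * n := by
    calc ‖toEuclidean v‖ * n = ∑ i, |‖toEuclidean v‖ * (u.1 i : ℝ)| := by
          rw [← sum_abs_toEuclidean u, Finset.mul_sum]
          simp [abs_mul]
      _ = ∑ i, |‖toEuclidean u‖ * (v.1 i : ℝ)| := by simp only [hcoord]
      _ = ‖toEuclidean u‖ * n := by
          rw [← sum_abs_toEuclidean v, Finset.mul_sum]
          simp [abs_mul]
  have hnorm := mul_right_cancel₀ (Nat.cast_ne_zero.mpr (NeZero.ne n)) hsum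
  ext i
  have := hcoord i
  rw [hnorm] at this
  exact_mod_cast mul_left_cancel₀ (by linarith : ‖toEuclidean u‖ ≠ 0) this

/-- The vertex `v` arises from `u` by moving one unit of mass from the coordinate `j` to the
coordinate `i`, inside the closed octant with signs `σ`. -/
structure IsTransfer {n : ℕ} (σ : Fin 3 → ℤ) (u : Vertex n) (i j : Fin 3) (v : Vertex n) :
    Prop where
  ne : i ≠ j
  sign : ∀ l, σ l = 1 ∨ σ l = -1
  nonneg : ∀ l, 0 ≤ σ l * u.1 l
  pos : 1 ≤ σ j * u.1 j
  up : v.1 i = u.1 i + σ i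
  down : v.1 j = u.1 j - σ j
  rest : ∀ l, l ≠ i → l ≠ j → v.1 l = u.1 l

theorem exists_isTransfer {n : ℕ} {σ : Fin 3 → ℤ} {u : Vertex n} {i j : Fin 3} (hij : i ≠ j)
    (hσ : ∀ l, σ l = 1 ∨ σ l = -1) (h0 : ∀ l, 0 ≤ σ l * u.1 l) (hj : 1 ≤ σ j * u.1 j) :
    ∃ v, IsTransfer σ u i j v := by
  obtain ⟨v, h1, h2, h3⟩ := exists_vertex_of_abs_add_abs u hij (a := u.1 i + σ i)
    (b := u.1 j - σ j) (by
      have hi := h0 i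
      rcases hσ i with h | h <;> rcases hσ j with h' | h' <;> rw [h] at hi ⊢ <;>
        rw [h'] at hj ⊢ <;> grind)
  exact ⟨v, hij, hσ, h0, hj, h1, h2, h3⟩

namespace IsTransfer

variable {n : ℕ} {σ : Fin 3 → ℤ} {u v : Vertex n} {i j : Fin 3}

theorem abs_sub_le_one (h : IsTransfer σ u i j v) (l : Fin 3) : |u.1 l - v.1 l| ≤ 1 := by
  have hl := h.sign l
  by_cases h1 : l = i
  · subst h1; rw [h.up]; grind
  by_cases h2 : l = j
  · subst h2; rw [h.down]; grind
  rw [h.rest l h1 h2]; simp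

theorem adj (h : IsTransfer σ u i j v) : (baseGraph n).Adj u v := by
  refine ⟨fun he => ?_, h.abs_sub_le_one⟩
  have h1 := h.up
  have h2 := h.sign i
  rw [← he] at h1
  omega

theorem nonneg_target (h : IsTransfer σ u i j v) (l : Fin 3) : 0 ≤ σ l * v.1 l := by
  have hl := h.sign l
  have h0 := h.nonneg l
  by_cases h1 : l = i
  · subst h1; rw [h.up]; rcases hl with hl | hl <;> rw [hl] at h0 ⊢ <;> omega
  by_cases h2 : l = j
  · subst h2
    have hp := h.pos
    rw [h.down]; rcases hl with hl | hl <;> rw [hl] at hp ⊢ <;> omega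
  rwa [h.rest l h1 h2]

theorem norm_sub_sq (h : IsTransfer σ u i j v) : ‖toEuclidean u - toEuclidean v‖ ^ 2 = 2 := by
  obtain ⟨k, hki, hkj, -⟩ := exists_third h.ne
  rw [EuclideanSpace.norm_sq_eq, sum_fin_three_eq _ h.ne hki hkj]
  simp only [PiLp.sub_apply, toEuclidean_apply, h.up, h.down, h.rest k hki hkj]
  rcases h.sign i with h1 | h1 <;> rcases h.sign j with h2 | h2 <;> rw [h1, h2] <;>
    norm_num

theorem norm_sq_eq (h : IsTransfer σ u i j v) : ‖toEuclidean v‖ ^ 2 =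
    ‖toEuclidean u‖ ^ 2 + 2 * ((σ i * u.1 i : ℤ) - (σ j * u.1 j : ℤ) + 1) := by
  obtain ⟨k, hki, hkj, -⟩ := exists_third h.ne
  rw [norm_sq_toEuclidean, norm_sq_toEuclidean, sum_fin_three_eq _ h.ne hki hkj,
    sum_fin_three_eq _ h.ne hki hkj, h.up, h.down, h.rest k hki hkj]
  rcases h.sign i with h1 | h1 <;> rcases h.sign j with h2 | h2 <;> rw [h1, h2] <;>
    push_cast <;> ring

theorem cast_le_norm (h : IsTransfer σ u i j v) (l : Fin 3) :
    ((σ l * u.1 l : ℤ) : ℝ) ≤ ‖toEuclidean u‖ := by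
  refine le_trans ?_ (abs_le_norm_toEuclidean u l)
  have : σ l * u.1 l ≤ |u.1 l| := by
    rcases h.sign l with h1 | h1 <;> rw [h1] <;> grind
  exact_mod_cast this

theorem norm_sq_sub_le (h : IsTransfer σ u i j v) :
    ‖toEuclidean u‖ ^ 2 - ‖toEuclidean v‖ ^ 2 ≤ 2 * ‖toEuclidean u‖ - 2 := by
  have h1 := h.norm_sq_eq
  have h2 := h.cast_le_norm j
  have h3 : (0 : ℝ) ≤ ((σ i * u.1 i : ℤ) : ℝ) := by exact_mod_cast h.nonneg i
  linarith

theorem norm_le (h : IsTransfer σ u i j v) : ‖toEuclidean v‖ ≤ ‖toEuclidean u‖ + 1 := by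
  have h1 := h.norm_sq_eq
  have h2 := h.cast_le_norm i
  have h3 : (1 : ℝ) ≤ ((σ j * u.1 j : ℤ) : ℝ) := by exact_mod_cast h.pos
  have h4 := norm_nonneg (toEuclidean u)
  refine le_of_sq_le_sq ?_ (by linarith)
  linarith

end IsTransfer

theorem sum_sign_mul {n : ℕ} {σ : Fin 3 → ℤ} (hσ : ∀ l, σ l = 1 ∨ σ l = -1) {u : Vertex n}
    (h0 : ∀ l, 0 ≤ σ l * u.1 l) : ∑ l, σ l * u.1 l = n := by
  refine (Finset.sum_congr rfl fun l _ => ?_).trans u.2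
  have := h0 l
  rcases hσ l with h | h <;> rw [h] at this ⊢ <;> grind

/-- A vertex in the cone over a triangle of the octahedral triangulation is close to each
corner. -/
theorem abs_sub_le_one_of_mem_cone {n : ℕ} [NeZero n] {σ : Fin 3 → ℤ}
    {u v w t : Vertex n} {i j i' j' : Fin 3} (hv : IsTransfer σ u i j v)
    (hw : IsTransfer σ u i' j' w) {α β γ : ℝ} (hα : 0 ≤ α) (hβ : 0 ≤ β) (hγ : 0 ≤ γ)
    (ht : ∀ l, (t.1 l : ℝ) = α * u.1 l + β * v.1 l + γ * w.1 l) (l : Fin 3) :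
    |u.1 l - t.1 l| ≤ 1 := by
  have hst : ∀ l, ((σ l * t.1 l : ℤ) : ℝ) =
      α * (σ l * u.1 l : ℤ) + β * (σ l * v.1 l : ℤ) + γ * (σ l * w.1 l : ℤ) := fun l => by
    push_cast
    rw [ht l]
    ring
  have ht0 : ∀ l, 0 ≤ σ l * t.1 l := fun l => by
    have h1 : (0 : ℝ) ≤ (σ l * u.1 l : ℤ) := by exact_mod_cast hv.nonneg l
    have h2 : (0 : ℝ) ≤ (σ l * v.1 l : ℤ) := by exact_mod_cast hv.nonneg_target l
    have h3 : (0 : ℝ) ≤ (σ l * w.1 l : ℤ) := by exact_mod_cast hw.nonneg_target l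
    have : (0 : ℝ) ≤ (σ l * t.1 l : ℤ) := by
      rw [hst l]
      positivity
    exact_mod_cast this
  -- All four vertices lie on the same face of the octahedron, so the conic combination is convex.
  have hsum : (n : ℝ) = (α + β + γ) * n := by
    have e : ∀ {x : Vertex n}, (∀ l, 0 ≤ σ l * x.1 l) → ∑ l, ((σ l * x.1 l : ℤ) : ℝ) = n :=
      fun hx => by exact_mod_cast sum_sign_mul hv.sign hx
    have h1 := Finset.sum_congr (rfl : (Finset.univ : Finset (Fin 3)) = _) fun l _ => hst l
    rw [Finset.sum_add_distrib, Finset.sum_add_distrib, ← Finset.mul_sum, ← Finset.mul_sum,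
      ← Finset.mul_sum, e ht0, e hv.nonneg, e hv.nonneg_target, e hw.nonneg_target] at h1
    linarith
  have hn : (n : ℝ) ≠ 0 := Nat.cast_ne_zero.mpr (NeZero.ne n)
  have hone : α + β + γ = 1 := mul_right_cancel₀ hn (by linarith)
  have hv1 : |(u.1 l : ℝ) - v.1 l| ≤ 1 := by exact_mod_cast hv.abs_sub_le_one l
  have hw1 : |(u.1 l : ℝ) - w.1 l| ≤ 1 := by exact_mod_cast hw.abs_sub_le_one l
  have : |(u.1 l : ℝ) - t.1 l| ≤ 1 := by
    have h1 : (u.1 l : ℝ) - t.1 l = β * (u.1 l - v.1 l) + γ * (u.1 l - w.1 l) := by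
      rw [ht l]
      linear_combination (-(u.1 l : ℝ)) * hone
    rw [h1]
    refine (abs_add_le _ _).trans ?_
    rw [abs_mul, abs_mul, abs_of_nonneg hβ, abs_of_nonneg hγ]
    nlinarith
  exact_mod_cast this

/-- The direction of `v` is closer than that of `u` to the direction of `t`. -/
def Closer {n : ℕ} (t v u : Vertex n) : Prop :=
  inner ℝ (toEuclidean t) (toEuclidean u) * ‖toEuclidean v‖ <
    inner ℝ (toEuclidean t) (toEuclidean v) * ‖toEuclidean u‖

theorem closer_self {n : ℕ} [NeZero n] {t u : Vertex n} (h : u ≠ t) : Closer t t u := by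
  have h1 := inner_lt_norm_mul_norm h.symm
  have h2 := one_le_norm_toEuclidean t
  unfold Closer
  rw [real_inner_self_eq_norm_sq]
  nlinarith

/-- If neither `v` nor `w` were closer, non-obtuseness would give `0 ≤ α`. Then `t` would lie in the
triangle, hence be a neighbour of `u`, and `t` is closer to itself than `u` is. -/
theorem adj_or_closer_of_transfers {n : ℕ} [NeZero n] {σ : Fin 3 → ℤ}
    {u v w t : Vertex n} {i j i' j' : Fin 3} (hv : IsTransfer σ u i j v)
    (hw : IsTransfer σ u i' j' w) (hvw : ‖toEuclidean v - toEuclidean w‖ ^ 2 = 2)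
    {α β γ : ℝ} (hβ : 0 ≤ β) (hγ : 0 ≤ γ)
    (ht : ∀ l, (t.1 l : ℝ) = α * u.1 l + β * v.1 l + γ * w.1 l) (hut : u ≠ t) :
    ∃ v', (baseGraph n).Adj u v' ∧ Closer t v' u := by
  by_contra! h
  have hα := coeff_nonneg_of_nonobtuse (inner_lt_norm_mul_norm hv.adj.ne)
    (inner_lt_norm_mul_norm hw.adj.ne)
    (nonobtuse_of_side_bounds (one_le_norm_toEuclidean u) hv.norm_sub_sq hw.norm_sub_sq hvw
      hv.norm_sq_sub_le hv.norm_le hw.norm_sq_sub_le hw.norm_le)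
    (t := toEuclidean t) (α := α) (by ext l; simpa using ht l) hβ hγ
    (not_lt.mp (h v hv.adj)) (not_lt.mp (h w hw.adj))
  exact h t ⟨hut, abs_sub_le_one_of_mem_cone hv hw hα hβ hγ ht⟩ (closer_self hut)

theorem norm_sub_sq_of_transfers_from {n : ℕ} {σ : Fin 3 → ℤ} {u v w : Vertex n} {i j k : Fin 3}
    (hv : IsTransfer σ u i j v) (hw : IsTransfer σ u i k w) (hjk : j ≠ k) :
    ‖toEuclidean v - toEuclidean w‖ ^ 2 = 2 := by
  rw [EuclideanSpace.norm_sq_eq, sum_fin_three_eq _ hjk hv.ne hw.ne]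
  simp only [PiLp.sub_apply, toEuclidean_apply, hv.up, hv.down, hw.up, hw.down,
    hv.rest k hw.ne.symm hjk.symm, hw.rest j hv.ne.symm hjk]
  rcases hv.sign k with h1 | h1 <;> rcases hv.sign j with h2 | h2 <;> rw [h1, h2] <;>
    norm_num

theorem norm_sub_sq_of_transfers_to {n : ℕ} {σ : Fin 3 → ℤ} {u v w : Vertex n} {i j k : Fin 3}
    (hv : IsTransfer σ u i k v) (hw : IsTransfer σ u j k w) (hij : i ≠ j) :
    ‖toEuclidean v - toEuclidean w‖ ^ 2 = 2 := by
  rw [EuclideanSpace.norm_sq_eq, sum_fin_three_eq _ hij hv.ne.symm hw.ne.symm]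
  simp only [PiLp.sub_apply, toEuclidean_apply, hv.up, hv.down, hw.up, hw.down,
    hv.rest j hij.symm hw.ne, hw.rest i hij hv.ne]
  rcases hv.sign i with h1 | h1 <;> rcases hv.sign j with h2 | h2 <;> rw [h1, h2] <;>
    norm_num

/-- Here `c` must be negative, so `u` points opposite to `t` and every other direction is closer. -/
theorem closer_of_smul {n : ℕ} [NeZero n] {u t v : Vertex n} {c : ℝ}
    (h : ∀ l, (t.1 l : ℝ) = c * u.1 l) (hut : u ≠ t) (huv : u ≠ v) : Closer t v u := by
  have ht : toEuclidean t = c • toEuclidean u := by ext l; simpa using h l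
  have h1 := one_le_norm_toEuclidean u
  have hc : c < 0 := by
    by_contra! hc
    have := inner_lt_norm_mul_norm hut
    rw [ht, inner_smul_right, norm_smul, Real.norm_of_nonneg hc, real_inner_self_eq_norm_sq]
      at this
    linarith
  have h2 := inner_lt_norm_mul_norm huv
  unfold Closer
  rw [ht, inner_smul_left, inner_smul_left, real_inner_self_eq_norm_sq, RCLike.conj_to_real]
  have : c * (‖toEuclidean u‖ * (‖toEuclidean u‖ * ‖toEuclidean v‖)) <
      c * (‖toEuclidean u‖ * inner ℝ (toEuclidean u) (toEuclidean v)) := by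
    refine mul_lt_mul_of_neg_left ?_ hc
    exact mul_lt_mul_of_pos_left h2 (by linarith)
  linarith

/-- Selects an octant containing `u`. Where `u` vanishes the sign follows `t`, so that no transfer
will be asked to take mass from an empty coordinate. -/
theorem exists_sign_pattern {n : ℕ} (u t : Vertex n) : ∃ σ : Fin 3 → ℤ,
    (∀ l, σ l = 1 ∨ σ l = -1) ∧ (∀ l, 0 ≤ σ l * u.1 l) ∧
      ∀ l, u.1 l = 0 → 0 ≤ σ l * t.1 l := by
  have : ∀ l, ∃ s : ℤ, (s = 1 ∨ s = -1) ∧ 0 ≤ s * u.1 l ∧ (u.1 l = 0 → 0 ≤ s * t.1 l) := by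
    intro l
    rcases lt_trichotomy (u.1 l) 0 with h | h | h
    · exact ⟨-1, by simp, by omega, by omega⟩
    · rcases le_total 0 (t.1 l) with h' | h'
      · exact ⟨1, by simp, by omega, by omega⟩
      · exact ⟨-1, by simp, by omega, by omega⟩
    · exact ⟨1, by simp, by omega, by omega⟩
  choose σ h using this
  exact ⟨σ, fun l => (h l).1, fun l => (h l).2.1, fun l => (h l).2.2⟩

/-- Three reals with sum zero, not all zero: one of them is positive and the other two negative,
or one is negative and the other two nonnegative. -/
theorem exists_sign_split {z : Fin 3 → ℝ} (hz : ∑ l, z l = 0) (h0 : ¬ ∀ l, z l = 0) :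
    ∃ i j k : Fin 3, i ≠ j ∧ k ≠ i ∧ k ≠ j ∧
      ((z j < 0 ∧ z k < 0) ∨ (0 ≤ z i ∧ 0 ≤ z j ∧ z k < 0)) := by
  obtain ⟨k, hk⟩ : ∃ k, z k < 0 := by
    by_contra! h
    exact h0 fun l => (Finset.sum_eq_zero_iff_of_nonneg fun i _ => h i).mp hz l (Finset.mem_univ l)
  obtain ⟨i, hik⟩ : ∃ i : Fin 3, i ≠ k := exists_ne k
  obtain ⟨j, hji, hjk, -⟩ := exists_third hik
  by_cases hj : z j < 0
  · exact ⟨i, j, k, hji.symm, hik.symm, hjk.symm, Or.inl ⟨hj, hk⟩⟩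
  by_cases hi : z i < 0
  · exact ⟨j, i, k, hji, hjk.symm, hik.symm, Or.inl ⟨hi, hk⟩⟩
  exact ⟨i, j, k, hji.symm, hik.symm, hjk.symm, Or.inr ⟨not_lt.mp hi, not_lt.mp hj, hk⟩⟩

/-- Every vertex other than the target has a neighbour in the octahedral graph whose direction is
closer to that of the target. -/
theorem exists_adj_closer {n : ℕ} [NeZero n] {u t : Vertex n} (hut : u ≠ t) :
    ∃ v, (baseGraph n).Adj u v ∧ Closer t v u := by
  obtain ⟨σ, hσ, hu0, ht0⟩ := exists_sign_pattern u t
  have hσ2 : ∀ l, (σ l : ℝ) * σ l = 1 := fun l => by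
    rcases hσ l with h | h <;> rw [h] <;> norm_num
  -- This `c` makes the signed coordinates of `t - c * u` sum to zero, so they describe a flow of
  -- mass. Its sign pattern selects the triangle at `u` to use: two sources and one sink, or one
  -- source and two sinks.
  set c : ℝ := (∑ l, σ l * t.1 l : ℤ) / n
  let z : Fin 3 → ℝ := fun l => σ l * t.1 l - c * (σ l * u.1 l)
  have htz : ∀ l, (t.1 l : ℝ) = c * u.1 l + σ l * z l := fun l => by
    simp only [z]
    linear_combination (-(t.1 l : ℝ) + c * u.1 l) * hσ2 l
  have hz : ∑ l, z l = 0 := by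
    have h1 : ∑ l, (σ l : ℝ) * u.1 l = n := by exact_mod_cast sum_sign_mul hσ hu0
    have hn : (n : ℝ) ≠ 0 := Nat.cast_ne_zero.mpr (NeZero.ne n)
    simp only [z, c]
    rw [Finset.sum_sub_distrib, ← Finset.mul_sum, h1]
    push_cast
    field_simp
    ring
  by_cases hzero : ∀ l, z l = 0
  · obtain ⟨v, hv⟩ := exists_adj n u
    exact ⟨v, hv, closer_of_smul (c := c) (fun l => by rw [htz l, hzero l]; ring) hut hv.ne⟩
  have hpos : ∀ l, z l < 0 → 1 ≤ σ l * u.1 l := fun l hl => by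
    by_contra h
    have h1 : σ l * u.1 l = 0 := by have := hu0 l; omega
    have h2 : u.1 l = 0 := by
      rcases hσ l with h' | h' <;> rw [h'] at h1 <;> omega
    have h3 : (0 : ℝ) ≤ σ l * t.1 l := by exact_mod_cast ht0 l h2
    simp only [z, h2, Int.cast_zero, mul_zero, sub_zero] at hl
    linarith
  obtain ⟨i, j, k, hij, hki, hkj, h⟩ := exists_sign_split hz hzero
  rw [sum_fin_three_eq z hij hki hkj] at hz
  have hall : ∀ l, l = i ∨ l = j ∨ l = k := by
    clear h hz
    decide +revert
  rcases h with ⟨hj, hk⟩ | ⟨hi, hj, hk⟩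
  · obtain ⟨v, hv⟩ := exists_isTransfer hij hσ hu0 (hpos j hj)
    obtain ⟨w, hw⟩ := exists_isTransfer hki.symm hσ hu0 (hpos k hk)
    refine adj_or_closer_of_transfers hv hw (norm_sub_sq_of_transfers_from hv hw hkj.symm)
      (α := c + z j + z k) (β := -z j) (γ := -z k) (by linarith) (by linarith) ?_ hut
    intro l
    rw [htz l]
    rcases hall l with rfl | rfl | rfl
    · rw [hv.up, hw.up]
      push_cast
      linear_combination (σ l : ℝ) * hz
    · rw [hv.down, hw.rest _ hij.symm hkj.symm]
      push_cast
      ring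
    · rw [hw.down, hv.rest _ hki hkj]
      push_cast
      ring
  · obtain ⟨v, hv⟩ := exists_isTransfer hki.symm hσ hu0 (hpos k hk)
    obtain ⟨w, hw⟩ := exists_isTransfer hkj.symm hσ hu0 (hpos k hk)
    refine adj_or_closer_of_transfers hv hw (norm_sub_sq_of_transfers_to hv hw hij)
      (α := c - z i - z j) (β := z i) (γ := z j) hi hj ?_ hut
    intro l
    rw [htz l]
    rcases hall l with rfl | rfl | rfl
    · rw [hv.up, hw.rest _ hij hki.symm]
      push_cast
      ring
    · rw [hw.up, hv.rest _ hij.symm hkj.symm]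
      push_cast
      ring
    · rw [hv.down, hw.down]
      push_cast
      linear_combination (σ l : ℝ) * hz

/-! ### The chord as a measure of angle and of ℓ¹ distance. -/

/-- The Euclidean distance between the directions of two vertices. -/
noncomputable def chord {n : ℕ} (v t : Vertex n) : ℝ :=
  ‖‖toEuclidean v‖⁻¹ • toEuclidean v - ‖toEuclidean t‖⁻¹ • toEuclidean t‖

theorem chord_nonneg {n : ℕ} (v t : Vertex n) : 0 ≤ chord v t := norm_nonneg _

theorem chord_sq {n : ℕ} [NeZero n] (v t : Vertex n) :
    chord v t ^ 2 = 2 - 2 * (inner ℝ (toEuclidean v) (toEuclidean t) /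
      (‖toEuclidean v‖ * ‖toEuclidean t‖)) := by
  have hv := one_le_norm_toEuclidean v
  have ht := one_le_norm_toEuclidean t
  rw [chord, norm_sub_sq_real, norm_smul, norm_smul, inner_smul_left, inner_smul_right,
    RCLike.conj_to_real, norm_inv, norm_inv, norm_norm, norm_norm,
    inv_mul_cancel₀ (by linarith), inv_mul_cancel₀ (by linarith)]
  field_simp
  ring

theorem vertexAngle_le_iff {n : ℕ} [NeZero n] (v w t : Vertex n) :
    vertexAngle v t ≤ vertexAngle w t ↔ chord v t ≤ chord w t := by
  have hcos : ∀ x : Vertex n, Real.cos (vertexAngle x t) = 1 - chord x t ^ 2 / 2 := fun x => by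
    rw [chord_sq, vertexAngle, InnerProductGeometry.cos_angle]
    unfold toEuclidean
    ring
  have hmem : ∀ x : Vertex n, vertexAngle x t ∈ Set.Icc 0 Real.pi := fun x =>
    ⟨InnerProductGeometry.angle_nonneg _ _, InnerProductGeometry.angle_le_pi _ _⟩
  rw [← Real.strictAntiOn_cos.le_iff_ge (hmem w) (hmem v), hcos, hcos,
    ← pow_le_pow_iff_left₀ (chord_nonneg v t) (chord_nonneg w t) two_ne_zero]
  constructor <;> intro h <;> linarith

theorem Closer.chord_lt {n : ℕ} [NeZero n] {t v u : Vertex n} (h : Closer t v u) :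
    chord v t < chord u t := by
  have hv := one_le_norm_toEuclidean v
  have hu := one_le_norm_toEuclidean u
  have ht := one_le_norm_toEuclidean t
  refine lt_of_pow_lt_pow_left₀ 2 (chord_nonneg u t) ?_
  rw [chord_sq, chord_sq]
  have : inner ℝ (toEuclidean u) (toEuclidean t) / (‖toEuclidean u‖ * ‖toEuclidean t‖) <
      inner ℝ (toEuclidean v) (toEuclidean t) / (‖toEuclidean v‖ * ‖toEuclidean t‖) := by
    rw [div_lt_div_iff₀ (by positivity) (by positivity)]
    unfold Closer at h
    rw [real_inner_comm, real_inner_comm (toEuclidean v)] at h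
    nlinarith
  linarith

/-- Scaling `t` to the length of `v` leaves a coordinatewise error of at most `n * d`, so `3 * (n *
d)` in all. As both ℓ¹ norms equal `n`, undoing the scaling costs no more than that again. -/
theorem l1dist_le_chord {n : ℕ} [NeZero n] (v t : Vertex n) :
    (l1dist v t : ℝ) ≤ 6 * (n * chord v t) := by
  set a := ‖toEuclidean v‖ with ha_def
  set b := ‖toEuclidean t‖ with hb_def
  have ha : 1 ≤ a := one_le_norm_toEuclidean v
  have hb : 1 ≤ b := one_le_norm_toEuclidean t
  have han : a ≤ n := norm_toEuclidean_le v
  set d := chord v t with hd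
  have hd0 : 0 ≤ d := chord_nonneg v t
  have hw : ∀ i, |(v.1 i : ℝ) - a / b * t.1 i| ≤ n * d := fun i => by
    have h1 := PiLp.norm_apply_le (a⁻¹ • toEuclidean v - b⁻¹ • toEuclidean t) i
    rw [← chord.eq_1 v t, ← hd] at h1
    simp only [PiLp.sub_apply, PiLp.smul_apply, toEuclidean_apply, smul_eq_mul,
      Real.norm_eq_abs] at h1
    have h2 : (v.1 i : ℝ) - a / b * t.1 i = a * (a⁻¹ * v.1 i - b⁻¹ * t.1 i) := by
      field_simp
    rw [h2, abs_mul, abs_of_pos (by linarith : 0 < a)]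
    exact mul_le_mul han h1 (abs_nonneg _) (by linarith)
  have hsum : ∑ i, |(v.1 i : ℝ) - a / b * t.1 i| ≤ 3 * (n * d) := by
    rw [Fin.sum_univ_three]
    linarith [hw 0, hw 1, hw 2]
  have hn : n * |1 - a / b| ≤ 3 * (n * d) := by
    refine le_trans ?_ hsum
    have h1 : (n : ℝ) * (1 - a / b) = ∑ i, (|(v.1 i : ℝ)| - |a / b * t.1 i|) := by
      rw [Finset.sum_sub_distrib, sum_abs_toEuclidean]
      simp only [abs_mul, abs_of_nonneg (by positivity : 0 ≤ a / b)]
      rw [← Finset.mul_sum, sum_abs_toEuclidean]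
      ring
    have h2 : n * |1 - a / b| = |n * (1 - a / b)| := by
      rw [abs_mul, abs_of_nonneg (Nat.cast_nonneg' n : (0 : ℝ) ≤ n)]
    rw [h2, h1]
    refine (Finset.abs_sum_le_sum_abs _ _).trans (Finset.sum_le_sum fun i _ => ?_)
    exact abs_abs_sub_abs_le_abs_sub _ _
  calc (l1dist v t : ℝ) = ∑ i, |(v.1 i : ℝ) - t.1 i| := by
        unfold l1dist
        push_cast
        rfl
    _ ≤ ∑ i, (|(v.1 i : ℝ) - a / b * t.1 i| + |1 - a / b| * |(t.1 i : ℝ)|) := by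
        refine Finset.sum_le_sum fun i _ => ?_
        rw [← abs_mul]
        refine le_trans (le_of_eq ?_) (abs_sub _ _)
        congr 1
        ring
    _ ≤ 6 * (n * d) := by
        rw [Finset.sum_add_distrib, ← Finset.mul_sum, sum_abs_toEuclidean]
        linarith

/-- Normalizing vectors of length about `a` expands distances by at most `2 / a`, and `a ≥ n / 3`.
-/
theorem chord_le_l1dist {n : ℕ} [NeZero n] (v t : Vertex n) :
    n * chord v t ≤ 6 * l1dist v t := by
  set a := ‖toEuclidean v‖ with ha_def
  set b := ‖toEuclidean t‖ with hb_def
  have ha : 1 ≤ a := one_le_norm_toEuclidean v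
  have hb : 1 ≤ b := one_le_norm_toEuclidean t
  have hdiff : ‖toEuclidean v - toEuclidean t‖ ≤ l1dist v t := by
    have h := l1dist_nonneg v t
    refine le_of_sq_le_sq ?_ (by exact_mod_cast h)
    rw [EuclideanSpace.norm_sq_eq]
    unfold l1dist
    push_cast
    simp only [PiLp.sub_apply, toEuclidean_apply, Real.norm_eq_abs]
    exact Finset.sum_sq_le_sq_sum_of_nonneg fun i _ => abs_nonneg _
  have key : a * chord v t ≤ 2 * ‖toEuclidean v - toEuclidean t‖ := by
    have h1 : a * chord v t = ‖(toEuclidean v - toEuclidean t) +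
        ((b - a) * b⁻¹) • toEuclidean t‖ := by
      rw [chord, ← ha_def, ← hb_def]
      nth_rw 1 [← abs_of_nonneg (by linarith : 0 ≤ a)]
      rw [← Real.norm_eq_abs, ← norm_smul, smul_sub, smul_smul, smul_smul,
        mul_inv_cancel₀ (by linarith), sub_mul, mul_inv_cancel₀ (by linarith), sub_smul]
      congr 1
      module
    rw [h1]
    refine (norm_add_le _ _).trans ?_
    rw [norm_smul, norm_mul, norm_inv, ← hb_def, Real.norm_of_nonneg (by linarith : 0 ≤ b),
      inv_mul_cancel_right₀ (by linarith), Real.norm_eq_abs, abs_sub_comm]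
    linarith [abs_norm_sub_norm_le (toEuclidean v) (toEuclidean t)]
  have h3 := le_three_mul_norm_toEuclidean v
  nlinarith [chord_nonneg v t]

theorem one_le_six_mul_chord {n : ℕ} [NeZero n] {u t : Vertex n} (h : u ≠ t) :
    1 ≤ 6 * (n * chord u t) :=
  le_trans (by exact_mod_cast one_le_l1dist h) (l1dist_le_chord u t)

/-! ### Long-range edges halve the distance with probability of order at least `1 / log n`. -/

theorem inv_le_normFactor {n : ℕ} [NeZero n] (hn : 2 ≤ n) (u : Vertex n) :
    (80 * Real.log n)⁻¹ ≤ normFactor n u := by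
  obtain ⟨x, hx⟩ := exists_adj n u
  have hS : 0 < ∑ w ∈ Finset.univ.erase u, (((baseGraph n).dist u w : ℝ) ^ 2)⁻¹ := by
    refine Finset.sum_pos' (fun _ _ => by positivity)
      ⟨x, Finset.mem_erase.mpr ⟨hx.ne', Finset.mem_univ _⟩, ?_⟩
    rw [SimpleGraph.dist_eq_one_iff_adj.mpr hx]
    norm_num
  exact inv_anti₀ hS (sum_dist_sq_inv_le_log hn u)

theorem le_linkProb {n : ℕ} [NeZero n] (hn : 2 ≤ n) {u x : Vertex n} (hxu : x ≠ u) {R : ℝ}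
    (hR : 125 * (l1dist u x : ℝ) ≤ R) :
    (80 * Real.log n)⁻¹ * (R ^ 2)⁻¹ ≤ linkProb n u x := by
  have hpos : (0 : ℝ) < (baseGraph n).dist u x :=
    Nat.cast_pos.mpr ((baseGraph_reachable u x).pos_dist_of_ne hxu.symm)
  have hdist : ((baseGraph n).dist u x : ℝ) ≤ R :=
    le_trans (by exact_mod_cast dist_le_l1dist u x) hR
  have hlog : 0 ≤ Real.log n := Real.log_nonneg (by exact_mod_cast NeZero.pos n)
  rw [linkProb, if_neg hxu]
  exact mul_le_mul (inv_le_normFactor hn u) (by gcongr) (by positivity)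
    ((by positivity : 0 ≤ (80 * Real.log n)⁻¹).trans (inv_le_normFactor hn u))

/-- The probability that the long-range edge halves the distance to the target is at least
inversely proportional to `log n`. -/
theorem le_sum_linkProb_halving {n : ℕ} [NeZero n] (hn : 2 ≤ n) {u t : Vertex n} (hut : u ≠ t) :
    (80 * (250 * 288 : ℝ) ^ 2 * Real.log n)⁻¹ ≤
      ∑ x ∈ Finset.univ.filter fun x => chord x t ≤ chord u t / 2, linkProb n u x := by
  have hD1 := one_le_l1dist hut
  have hD2 := l1dist_le u t
  have hDc := l1dist_le_chord u t
  -- `288 = 12 * 24`: on the ball of radius `4 * m`, `n * chord` is at most `24 * m ≤ D / 12`, which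
  -- is at most half its value at `u`. The bound `D ≤ 2 * n` gives `6 * m ≤ n`. For `m = 0` the ball
  -- still contains `t`.
  obtain ⟨m, hm1, hm2⟩ : ∃ m : ℕ, 288 * (m : ℤ) ≤ l1dist u t ∧ l1dist u t ≤ 288 * (m + 1) :=
    ⟨(l1dist u t).toNat / 288, by omega, by omega⟩
  have hlog : 0 < Real.log n := Real.log_pos (by exact_mod_cast hn)
  obtain ⟨D, hD⟩ : ∃ D : ℝ, D = (l1dist u t : ℝ) := ⟨_, rfl⟩
  have hD1' : (1 : ℝ) ≤ D := by rw [hD]; exact_mod_cast hD1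
  have hm1' : 288 * (m : ℝ) ≤ D := by rw [hD]; exact_mod_cast hm1
  have hm2' : D ≤ 288 * ((m : ℝ) + 1) := by rw [hD]; exact_mod_cast hm2
  rw [← hD] at hDc
  have hn0 : (0 : ℝ) < n := by positivity
  obtain ⟨S, hS⟩ : ∃ S, S = Finset.univ.filter fun v => l1dist v t ≤ 4 * (m : ℤ) := ⟨_, rfl⟩
  have hcard : ((m : ℝ) + 1) ^ 2 ≤ S.card := by
    rw [hS]
    exact_mod_cast sq_le_card_l1dist_le t m (by omega)
  have hdist : ∀ x ∈ S, (l1dist x t : ℝ) ≤ 4 * m := fun x hx => by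
    rw [hS] at hx
    exact_mod_cast (Finset.mem_filter.mp hx).2
  have hnear : ∀ x ∈ S, n * chord x t ≤ D / 12 := fun x hx => by
    linarith [chord_le_l1dist x t, hdist x hx]
  have hsub : S ⊆ Finset.univ.filter fun x => chord x t ≤ chord u t / 2 := fun x hx => by
    refine Finset.mem_filter.mpr ⟨Finset.mem_univ _, ?_⟩
    have := hnear x hx
    refine le_of_mul_le_mul_left ?_ hn0
    linarith
  -- `l1dist u x ≤ D + 4 * m ≤ 2 * D`, whence `250 = 2 * 125`.
  have hlink : ∀ x ∈ S, (80 * Real.log n)⁻¹ * ((250 * D) ^ 2)⁻¹ ≤ linkProb n u x := fun x hx => by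
    refine le_linkProb hn ?_ ?_
    · rintro rfl
      linarith [hnear x hx]
    · have h2 : (l1dist u x : ℝ) ≤ l1dist u t + l1dist t x := by
        exact_mod_cast l1dist_triangle u t x
      rw [l1dist_comm t x, ← hD] at h2
      linarith [hdist x hx]
  calc (80 * (250 * 288 : ℝ) ^ 2 * Real.log n)⁻¹
      = (D / 288) ^ 2 * ((80 * Real.log n)⁻¹ * ((250 * D) ^ 2)⁻¹) := by
        have hD0 : D ≠ 0 := by linarith
        rw [mul_pow, mul_pow, div_pow, mul_inv, mul_inv, mul_inv, mul_inv, mul_inv]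
        field_simp
    _ ≤ S.card * ((80 * Real.log n)⁻¹ * ((250 * D) ^ 2)⁻¹) := by
        refine mul_le_mul_of_nonneg_right (le_trans ?_ hcard) (by positivity)
        exact pow_le_pow_left₀ (by positivity) (by linarith) 2
    _ ≤ ∑ x ∈ S, linkProb n u x := by
        rw [← nsmul_eq_mul]
        exact Finset.card_nsmul_le_sum _ _ _ hlink
    _ ≤ _ := Finset.sum_le_sum_of_subset_of_nonneg hsub fun x _ _ => linkProb_nonneg n u x

/-! ### Revealing the long-range edges one hop at a time. -/

/-- The vertex to which `u` forwards the message if its long-range edge ends in `x`. -/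
def hop {n : ℕ} (r : Vertex n → Vertex n → Set (Vertex n) → Vertex n) (t u x : Vertex n) :
    Vertex n :=
  r t u {v | (baseGraph n).Adj u v ∨ v = x}

theorem IsGreedyRule.chord_hop_le {n : ℕ} [NeZero n]
    {r : Vertex n → Vertex n → Set (Vertex n) → Vertex n} (hr : IsGreedyRule r)
    {t u x w : Vertex n} (hw : (baseGraph n).Adj u w ∨ w = x) :
    chord (hop r t u x) t ≤ chord w t :=
  (vertexAngle_le_iff _ _ _).mp ((hr t u {v | (baseGraph n).Adj u v ∨ v = x} ⟨w, hw⟩).2 w hw)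

theorem IsGreedyRule.chord_hop_lt {n : ℕ} [NeZero n]
    {r : Vertex n → Vertex n → Set (Vertex n) → Vertex n} (hr : IsGreedyRule r)
    {t u : Vertex n} (x : Vertex n) (hut : u ≠ t) : chord (hop r t u x) t < chord u t := by
  obtain ⟨v, hv, hc⟩ := exists_adj_closer hut
  exact (hr.chord_hop_le (Or.inl hv)).trans_lt hc.chord_lt

open Classical in
/-- An upper bound for the number of forwards from `u` to `t`, with value `⊤` if the target is not
reached after `k` forwards. -/
noncomputable def cappedForwards {n : ℕ} (r : Vertex n → Vertex n → Set (Vertex n) → Vertex n)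
    (t : Vertex n) : ℕ → (Vertex n → Vertex n) → Vertex n → ℝ≥0∞
  | 0, _, u => if u = t then 0 else ⊤
  | k + 1, ω, u => if u = t then 0 else 1 + cappedForwards r t k ω (hop r t u (ω u))

theorem forwards_self {n : ℕ} (r : Vertex n → Vertex n → Set (Vertex n) → Vertex n)
    (G : Digraph (Vertex n)) (t : Vertex n) : forwards r G t t = 0 :=
  le_antisymm (iInf₂_le_of_le 0 rfl (by simp)) zero_le

theorem forwards_le_one_add {n : ℕ} (r : Vertex n → Vertex n → Set (Vertex n) → Vertex n)
    (G : Digraph (Vertex n)) (s t : Vertex n) :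
    forwards r G s t ≤ 1 + forwards r G (r t s (outNeighbors G s)) t := by
  by_cases h : forwards r G (r t s (outNeighbors G s)) t = ⊤
  · simp [h]
  have hex : ∃ k, route r G (r t s (outNeighbors G s)) t k = t := by
    by_contra! hk
    exact h (by simp [forwards, hk])
  have : ∃ k, route r G (r t s (outNeighbors G s)) t k = t ∧
      (k : ℕ∞) ≤ forwards r G (r t s (outNeighbors G s)) t := by
    classical
    refine ⟨Nat.find hex, Nat.find_spec hex, le_iInf₂ fun k hk => ?_⟩
    exact_mod_cast Nat.find_min' hex hk
  obtain ⟨k, hk, hk'⟩ := this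
  refine (iInf₂_le (k + 1) hk).trans ?_
  rw [Nat.cast_add, Nat.cast_one, add_comm]
  gcongr

theorem forwards_le_cappedForwards {n : ℕ}
    (r : Vertex n → Vertex n → Set (Vertex n) → Vertex n) (t : Vertex n) (k : ℕ)
    (ω : Vertex n → Vertex n) (u : Vertex n) :
    ((forwards r (smallWorld n ω) u t : ℕ∞) : ℝ≥0∞) ≤ cappedForwards r t k ω u := by
  induction k generalizing u with
  | zero =>
    unfold cappedForwards
    split_ifs with h
    · simp [h, forwards_self]
    · exact le_top
  | succ k ih =>
    unfold cappedForwards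
    split_ifs with h
    · simp [h, forwards_self]
    · calc _ ≤ ((1 + forwards r (smallWorld n ω) (hop r t u (ω u)) t : ℕ∞) : ℝ≥0∞) :=
            ENat.toENNReal_le.mpr (forwards_le_one_add r (smallWorld n ω) u t)
        _ ≤ _ := by
            rw [ENat.toENNReal_add, ENat.toENNReal_one]
            gcongr
            exact ih _

/-- Only the long-range edges of vertices no farther from the target than the current one
matter. -/
theorem IsGreedyRule.cappedForwards_congr {n : ℕ} [NeZero n]
    {r : Vertex n → Vertex n → Set (Vertex n) → Vertex n} (hr : IsGreedyRule r) {t : Vertex n}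
    (k : ℕ) {ω ω' : Vertex n → Vertex n} {u : Vertex n}
    (h : ∀ v, chord v t ≤ chord u t → ω v = ω' v) :
    cappedForwards r t k ω u = cappedForwards r t k ω' u := by
  induction k generalizing u with
  | zero => rfl
  | succ k ih =>
    unfold cappedForwards
    split_ifs with hut
    · rfl
    · rw [h u le_rfl, ih fun v hv => h v (hv.trans (hr.chord_hop_lt _ hut).le)]

instance (n : ℕ) [NeZero n] (u : Vertex n) : IsProbabilityMeasure (linkPMF n u).toMeasure :=
  PMF.toMeasure.isProbabilityMeasure _

instance (n : ℕ) [NeZero n] : IsProbabilityMeasure (modelMeasure n) := by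
  unfold modelMeasure
  infer_instance

/-- Integration over the long-range edge of `u` when the integrand depends on it only through its
first argument. -/
theorem lintegral_modelMeasure_eq_sum {n : ℕ} [NeZero n] (u : Vertex n)
    (f : Vertex n → (Vertex n → Vertex n) → ℝ≥0∞)
    (hf : ∀ x ω y, f x (Function.update ω u y) = f x ω) :
    ∫⁻ ω, f (ω u) ω ∂(modelMeasure n) =
      ∑ x, ENNReal.ofReal (linkProb n u x) * ∫⁻ ω, f x ω ∂(modelMeasure n) := by
  classical
  have h1 : ∫⁻ ω, f (ω u) ω ∂(modelMeasure n) =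
      ∫⁻ ω, ∑ x, ENNReal.ofReal (linkProb n u x) * f x ω ∂(modelMeasure n) := by
    -- It suffices to compare the integrals over coordinate `u` alone.
    refine lintegral_eq_of_lmarginal_eq {u} Measurable.of_discrete Measurable.of_discrete ?_
    rw [lmarginal_singleton, lmarginal_singleton]
    funext ω
    have hfu : ∀ x y, f x (Function.update ω u y) = f x ω := fun x y => by
      convert hf x ω y
    simp only [Function.update_self, hfu, lintegral_const, measure_univ, mul_one]
    rw [lintegral_fintype]
    refine Finset.sum_congr rfl fun x _ => ?_
    rw [PMF.toMeasure_apply_singleton _ _ (measurableSet_singleton _), mul_comm]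
    rfl
  rw [h1, lintegral_finsetSum _ fun _ _ => Measurable.of_discrete]
  exact Finset.sum_congr rfl fun x _ => lintegral_const_mul _ Measurable.of_discrete

/-- A nonnegative function that drops by at least one in expectation at every forward bounds the
expected number of forwards. -/
theorem IsGreedyRule.lintegral_cappedForwards_le {n : ℕ} [NeZero n]
    {r : Vertex n → Vertex n → Set (Vertex n) → Vertex n} (hr : IsGreedyRule r) {t : Vertex n}
    {h : Vertex n → ℝ} (h0 : ∀ u, 0 ≤ h u)
    (hstep : ∀ u, u ≠ t → 1 + ∑ x, linkProb n u x * h (hop r t u x) ≤ h u)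
    (k : ℕ) (u : Vertex n) (hk : {v | chord v t < chord u t}.ncard ≤ k) :
    ∫⁻ ω, cappedForwards r t k ω u ∂(modelMeasure n) ≤ ENNReal.ofReal (h u) := by
  have hchord : ∀ u, u ≠ t → chord t t < chord u t := fun u hu => (closer_self hu).chord_lt
  -- Each hop strictly shrinks the set of vertices closer than the current one, and an empty set
  -- forces `u = t`; so the value `⊤` is never met.
  induction k generalizing u with
  | zero =>
    have hut : u = t := by
      by_contra hut
      rw [Nat.le_zero, Set.ncard_eq_zero] at hk
      exact Set.eq_empty_iff_forall_notMem.mp hk t (hchord u hut)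
    simp [cappedForwards, hut]
  | succ k ih =>
    by_cases hut : u = t
    · simp [cappedForwards, hut]
    have hnext : ∀ x, {v | chord v t < chord (hop r t u x) t}.ncard ≤ k := fun x => by
      refine Nat.lt_succ_iff.mp (lt_of_lt_of_le (Set.ncard_lt_ncard ?_) hk)
      have hlt := hr.chord_hop_lt x hut
      refine (Set.ssubset_iff_of_subset fun v hv => hv.out.trans hlt).mpr
        ⟨hop r t u x, hlt, fun h => lt_irrefl _ h.out⟩
    -- The rest of the route consults only vertices strictly closer to `t` than `u`, so it ignores
    -- the edge of `u`.
    have hlocal : ∀ (x : Vertex n) (ω : Vertex n → Vertex n) (y : Vertex n),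
        cappedForwards r t k (Function.update ω u y) (hop r t u x) =
          cappedForwards r t k ω (hop r t u x) := fun x ω y => by
      refine hr.cappedForwards_congr k fun v hv => Function.update_of_ne ?_ _ _
      rintro rfl
      exact absurd (hr.chord_hop_lt x hut) (not_lt.mpr hv)
    simp only [cappedForwards, hut, if_false]
    rw [lintegral_add_left measurable_const, lintegral_one, measure_univ,
      lintegral_modelMeasure_eq_sum u (fun x ω => cappedForwards r t k ω (hop r t u x)) hlocal]
    calc _ ≤ 1 + ∑ x, ENNReal.ofReal (linkProb n u x) * ENNReal.ofReal (h (hop r t u x)) := by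
          gcongr with x
          exact ih _ (hnext x)
      _ = ENNReal.ofReal (1 + ∑ x, linkProb n u x * h (hop r t u x)) := by
          have hnn : ∀ x, 0 ≤ linkProb n u x * h (hop r t u x) := fun x =>
            mul_nonneg (linkProb_nonneg n u x) (h0 _)
          rw [ENNReal.ofReal_add zero_le_one (Finset.sum_nonneg fun x _ => hnn x),
            ENNReal.ofReal_one, ENNReal.ofReal_sum_of_nonneg fun x _ => hnn x]
          simp only [ENNReal.ofReal_mul (linkProb_nonneg n u _)]
      _ ≤ _ := ENNReal.ofReal_le_ofReal (hstep u hut)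

/-! ### The logarithmic potential. -/

/-- The logarithm of the distance to the target in units of a constant fraction of the mesh
size. -/
noncomputable def logDist {n : ℕ} (u t : Vertex n) : ℝ :=
  Real.log (max (12 * (n * chord u t)) 1)

theorem logDist_nonneg {n : ℕ} (u t : Vertex n) : 0 ≤ logDist u t :=
  Real.log_nonneg (le_max_right _ _)

theorem logDist_mono {n : ℕ} {u v t : Vertex n} (h : chord v t ≤ chord u t) :
    logDist v t ≤ logDist u t := by
  refine Real.log_le_log (by positivity) (max_le_max_right 1 ?_)
  gcongr

/-- For `u ≠ t` the factor `12` makes the argument at least `2`, so the truncation at `1` does not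
spoil the drop, even when `v = t`. -/
theorem logDist_le_sub_log_two {n : ℕ} [NeZero n] {u v t : Vertex n} (hut : u ≠ t)
    (h : chord v t ≤ chord u t / 2) : logDist v t ≤ logDist u t - Real.log 2 := by
  have h1 := one_le_six_mul_chord hut
  have h2 : (n : ℝ) * chord v t ≤ n * (chord u t / 2) := by gcongr
  rw [logDist, logDist, max_eq_left (by linarith : 1 ≤ 12 * (n * chord u t)),
    ← Real.log_div (by linarith) two_ne_zero]
  exact Real.log_le_log (by positivity) (max_le (by linarith) (by linarith))

theorem logDist_le {n : ℕ} [NeZero n] (hn : 2 ≤ n) (u t : Vertex n) :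
    logDist u t ≤ 9 * Real.log n := by
  have hn' : (2 : ℝ) ≤ n := by exact_mod_cast hn
  have h1 := chord_le_l1dist u t
  have h2 : (l1dist u t : ℝ) ≤ 2 * n := by exact_mod_cast l1dist_le u t
  -- The argument of the logarithm is at most `12 * 6 * 2 * n = 144 * n`, and `144 ≤ 2 ^ 8`.
  have h3 : (2 : ℝ) ^ 8 ≤ (n : ℝ) ^ 8 := pow_le_pow_left₀ (by norm_num) hn' 8
  calc logDist u t ≤ Real.log ((n : ℝ) ^ 9) := by
        refine Real.log_le_log (by positivity) (max_le ?_ (one_le_pow₀ (by linarith)))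
        rw [pow_succ]
        nlinarith
    _ = 9 * Real.log n := by rw [Real.log_pow]; norm_num

/-- The potential never increases, and it falls by `A * log 2` whenever the long-range end halves
the chord, since the greedy choice is at least as good as that end. `hA` makes the expected fall at
least `1`. -/
theorem IsGreedyRule.one_add_sum_le {n : ℕ} [NeZero n] (hn : 2 ≤ n)
    {r : Vertex n → Vertex n → Set (Vertex n) → Vertex n} (hr : IsGreedyRule r)
    {A : ℝ} (hA : 80 * (250 * 288 : ℝ) ^ 2 * Real.log n ≤ A * Real.log 2) {u t : Vertex n}
    (hut : u ≠ t) :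
    1 + ∑ x, linkProb n u x * (A * logDist (hop r t u x) t) ≤ A * logDist u t := by
  classical
  have hlog : 0 < Real.log n := Real.log_pos (by exact_mod_cast hn)
  have hlog2 : 0 < Real.log 2 := Real.log_pos (by norm_num)
  have hpos : 0 < 80 * (250 * 288 : ℝ) ^ 2 * Real.log n := by positivity
  have hA0 : 0 ≤ A := nonneg_of_mul_nonneg_left (hpos.le.trans hA) hlog2
  have hterm : ∀ x, linkProb n u x * (A * logDist (hop r t u x) t) ≤
      linkProb n u x * (A * logDist u t) -
        if chord x t ≤ chord u t / 2 then linkProb n u x * (A * Real.log 2) else 0 := fun x => by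
    have hp := linkProb_nonneg n u x
    split_ifs with hx
    · rw [← mul_sub, ← mul_sub]
      gcongr
      exact logDist_le_sub_log_two hut ((hr.chord_hop_le (Or.inr rfl)).trans hx)
    · rw [sub_zero]
      gcongr
      exact logDist_mono (hr.chord_hop_lt x hut).le
  have hsum := Finset.sum_le_sum fun x (_ : x ∈ Finset.univ) => hterm x
  rw [Finset.sum_sub_distrib, ← Finset.sum_mul, sum_linkProb, one_mul, ← Finset.sum_filter,
    ← Finset.sum_mul] at hsum
  have hone : 1 ≤ (∑ x ∈ Finset.univ.filter fun x => chord x t ≤ chord u t / 2,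
      linkProb n u x) * (A * Real.log 2) := by
    calc (1 : ℝ) = (80 * (250 * 288 : ℝ) ^ 2 * Real.log n)⁻¹ *
          (80 * (250 * 288 : ℝ) ^ 2 * Real.log n) := (inv_mul_cancel₀ hpos.ne').symm
      _ ≤ _ := by
        refine mul_le_mul ?_ hA hpos.le
          (Finset.sum_nonneg fun x _ => linkProb_nonneg n u x)
        convert le_sum_linkProb_halving hn hut
  linarith

end OctahedralSmallWorld

theorem mainTheorem1 :
    ∃ C : ℝ, 0 < C ∧ ∀ (n : ℕ) [NeZero n], 2 ≤ n →
      ∀ r : OctahedralSmallWorld.Vertex n → OctahedralSmallWorld.Vertex n →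
          Set (OctahedralSmallWorld.Vertex n) → OctahedralSmallWorld.Vertex n,
        OctahedralSmallWorld.IsGreedyRule r →
        ∀ s t : OctahedralSmallWorld.Vertex n,
          ∫⁻ ω, ((OctahedralSmallWorld.forwards r (OctahedralSmallWorld.smallWorld n ω) s t : ℕ∞)
              : ℝ≥0∞) ∂(OctahedralSmallWorld.modelMeasure n)
            ≤ ENNReal.ofReal (C * Real.log n ^ 2) := by
  have hlog2 : 0 < Real.log 2 := Real.log_pos (by norm_num)
  obtain ⟨B, hB⟩ : ∃ B : ℝ, B = 80 * (250 * 288 : ℝ) ^ 2 := ⟨_, rfl⟩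
  have hB0 : 0 < B := by rw [hB]; positivity
  refine ⟨B / Real.log 2 * 9, by positivity, fun n _ hn r hr s t => ?_⟩
  have hlog : 0 < Real.log n := Real.log_pos (by exact_mod_cast hn)
  set A : ℝ := B / Real.log 2 * Real.log n with hA
  have hA0 : 0 ≤ A := by positivity
  have hAB : 80 * (250 * 288 : ℝ) ^ 2 * Real.log n ≤ A * Real.log 2 := by
    rw [← hB, hA]
    exact le_of_eq (by field_simp)
  -- The cap is left open here; `le_rfl` later fixes it as the number of vertices strictly closer to
  -- `t` than `s`.
  calc _ ≤ ∫⁻ ω, OctahedralSmallWorld.cappedForwards r t _ ω s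
        ∂(OctahedralSmallWorld.modelMeasure n) :=
        MeasureTheory.lintegral_mono fun ω =>
          OctahedralSmallWorld.forwards_le_cappedForwards r t _ ω s
    _ ≤ ENNReal.ofReal (A * OctahedralSmallWorld.logDist s t) :=
        hr.lintegral_cappedForwards_le
          (h := fun u => A * OctahedralSmallWorld.logDist u t)
          (fun u => mul_nonneg hA0 (OctahedralSmallWorld.logDist_nonneg u t))
          (fun u hut => hr.one_add_sum_le hn hAB hut) _ s le_rfl
    _ ≤ _ := by
        refine ENNReal.ofReal_le_ofReal ?_
        have := mul_le_mul_of_nonneg_left (OctahedralSmallWorld.logDist_le hn s t) hA0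
        rw [hA] at this
        linarith
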